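/- Let $k\in\{3,4\}$. Let $W(\mathrm H_k)$ be the Coxeter group with simple reflections $r_1,\dots,r_k$, where the bond between nodes $1,2$ has label $5$, the bonds $2-3$ and (for $k=4$) $3-4$ are simple, and there are no other bonds. The Brauer algebra $\mathrm{Br}(\mathrm H_k)$ is the unital associative $\mathbb Z[\delta^{\pm1}]$-algebra generated by $r_1,\dots,r_k,e_1,\dots,e_k$ subject to - $r_i^2=1$, $r_ie_i=e_ir_i=e_i$, $e_i^2=\delta^2e_i$ for all $i$; - $r_ir_j=r_jr_i$, $e_ir_j=r_je_i$, $e_ie_j=e_je_i$ whenever there is no bond between $i\ne j$; - $r_ir_jr_i=r_jr_ir_j$, $r_jr_ie_j=e_ie_j$, $r_ie_jr_i=r_je_ir_j$ whenever $i,j$ are joined by a simple bond; - $r_1r_2r_1r_2r_1=r_2r_1r_2r_1r_2$, $r_1r_2e_1r_2r_1=r_2r_1e_2r_1r_2$, $e_1e_2e_1=e_1$, $e_1r_2e_1=e_1$, $e_1r_2r_1r_2e_1=e_1$; - for $k=4$ only: $e_1(r_2r_1r_2r_1r_3r_2r_1r_2r_3r_1r_2r_1r_2r_3r_4)^5=e_1$.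 The monoid $\mathrm{BrM}(\mathrm H_k)$ is the multiplicative submonoid of $\mathrm{Br}(\mathrm H_k)$ generated by $\delta$ and all $r_i,e_i$. The elements of $W(\mathrm H_k)$ are read in $\mathrm{Br}(\mathrm H_k)$ through the natural homomorphism. Let $\beta_1,\dots,\beta_k$ be the simple roots, of squared length $2$, with $(\beta_1,\beta_2)=-\varphi$, where $\varphi=\frac{1+\sqrt5}2$, with $(\beta_i,\beta_j)=-1$ for a simple bond and $(\beta_i,\beta_j)=0$ for no bond, and let $W(\mathrm H_k)$ act on the positive roots by its reflection action, negating negative roots. Put $\beta_5=\varphi^2\beta_1+2\varphi\beta_2+\varphi\beta_3$, let $r_5\in W(\mathrm H_k)$ be the reflection in $\beta_5$, and for $k=4$ put $\beta_7=\varphi^2\beta_5+2\varphi\beta_4+\varphi\beta_3$; then $\{\beta_1,\beta_3,\beta_5\}$ (for $k=3$) and $\{\beta_1,\beta_3,\beta_5,\beta_7\}$ (for $k=4$) are sets of mutually orthogonal positive roots. Let $N_1^k$ be the stabilizer of $\beta_1$ in $W(\mathrm H_k)$, and let $N_2^3$, $N_2^4$ be the (setwise) stabilizers of $\{\beta_1,\beta_3,\beta_5\}$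 in $W(\mathrm H_3)$ and of $\{\beta_1,\beta_3,\beta_5,\beta_7\}$ in $W(\mathrm H_4)$. Let $D_1^k$ and $D_2^k$ be arbitrary sets of representatives of the left cosets of $N_1^k$ and $N_2^k$ in $W(\mathrm H_k)$. Let $C_1^3=\langle r_3,r_5\rangle$, and let $C_1^4$ be an arbitrary set of representatives of the left cosets of $\langle (r_5r_3r_4)^5\rangle$ in $\langle r_3,r_4,r_5\rangle$. Theorem. Every element of $\mathrm{BrM}(\mathrm H_k)$ is equal to $\delta^n x$ for some $n\in\mathbb Z$ and some $x$ of one of the following forms: 1. $r$ with $r\in W(\mathrm H_k)$; 2. $u e_1 v w$ with $u,w^{-1}\in D_1^k$ and $v\in C_1^k$; 3. $u e_1e_3 w$ with $u,w^{-1}\in D_2^k$. The total number of these forms, that is $\#W(\mathrm H_k)+(\#D_1^k)^2\,\#C_1^k+(\#D_2^k)^2$, is $1045$ for $k=3$ and $236025$ for $k=4$. -/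

import Mathlib

namespace BrauerH

/-- The Coxeter matrix of type `H_k` (used for `k = 3, 4`): a path on the nodes `0, …, k - 1`
(node `i` is the node written `i + 1` in the usual numbering `1, …, k`), in which the bond between
the first two nodes has label `5` and all other bonds are simple. -/
def hMatrix (k : ℕ) : CoxeterMatrix (Fin k) where
  M := Matrix.of fun i j =>
    if i = j then 1
    else if i.val + j.val = 1 then 5
    else if i.val + 1 = j.val ∨ j.val + 1 = i.val then 3
    else 2
  isSymm := by
    refine Matrix.IsSymm.ext fun i j => ?_
    simp only [Matrix.of_apply, eq_comm (a := j) (b := i), add_comm j.val i.val,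
      or_comm (a := j.val + 1 = i.val)]
  diagonal i := by simp
  off_diagonal i j h := by
    simp only [Matrix.of_apply, h, if_false]
    split_ifs <;> decide

/-- The Coxeter group `W(H_k)`. -/
abbrev W (k : ℕ) : Type := (hMatrix k).Group

/-- The simple reflections, as elements of `W(H_k)`. -/
def s {k : ℕ} (i : Fin k) : W k := (hMatrix k).simple i

/-! ### The Brauer algebra -/

/-- The ground ring `ℤ[δ^{±1}]`. -/
abbrev Scalars : Type := LaurentPolynomial ℤ

/-- `δ ^ n` for an integer `n`. -/
noncomputable def deltaPow (n : ℤ) : Scalars := LaurentPolynomial.T n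

inductive Gen (k : ℕ) : Type
  | r (i : Fin k) : Gen k
  | e (i : Fin k) : Gen k

noncomputable abbrev freeR {k : ℕ} (i : Fin k) : FreeAlgebra Scalars (Gen k) :=
  FreeAlgebra.ι Scalars (Gen.r i)

noncomputable abbrev freeE {k : ℕ} (i : Fin k) : FreeAlgebra Scalars (Gen k) :=
  FreeAlgebra.ι Scalars (Gen.e i)

/-- The defining relations of `Br(H_k)`. Centrality and invertibility of `δ` are part of the
structure of an algebra over `ℤ[δ^{±1}]`. `hMatrix k i j = 3` says that `i` and `j` are joined by
a simple bond, `hMatrix k i j = 2` that there is no bond between them. -/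
inductive Rel (k : ℕ) [NeZero k] :
    FreeAlgebra Scalars (Gen k) → FreeAlgebra Scalars (Gen k) → Prop
  | r_sq (i : Fin k) : Rel k (freeR i * freeR i) 1
  | r_e (i : Fin k) : Rel k (freeR i * freeE i) (freeE i)
  | e_r (i : Fin k) : Rel k (freeE i * freeR i) (freeE i)
  | e_sq (i : Fin k) : Rel k (freeE i * freeE i) (deltaPow 2 • freeE i)
  | comm_rr (i j : Fin k) (h : hMatrix k i j = 2) : Rel k (freeR i * freeR j) (freeR j * freeR i)
  | comm_er (i j : Fin k) (h : hMatrix k i j = 2) : Rel k (freeE i * freeR j) (freeR j * freeE i)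
  | comm_ee (i j : Fin k) (h : hMatrix k i j = 2) : Rel k (freeE i * freeE j) (freeE j * freeE i)
  | braid3 (i j : Fin k) (h : hMatrix k i j = 3) :
      Rel k (freeR i * freeR j * freeR i) (freeR j * freeR i * freeR j)
  | rre (i j : Fin k) (h : hMatrix k i j = 3) :
      Rel k (freeR j * freeR i * freeE j) (freeE i * freeE j)
  | rer (i j : Fin k) (h : hMatrix k i j = 3) :
      Rel k (freeR i * freeE j * freeR i) (freeR j * freeE i * freeR j)
  | braid5 : Rel k (freeR 0 * freeR 1 * freeR 0 * freeR 1 * freeR 0)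
      (freeR 1 * freeR 0 * freeR 1 * freeR 0 * freeR 1)
  | rrerr : Rel k (freeR 0 * freeR 1 * freeE 0 * freeR 1 * freeR 0)
      (freeR 1 * freeR 0 * freeE 1 * freeR 0 * freeR 1)
  | eee : Rel k (freeE 0 * freeE 1 * freeE 0) (freeE 0)
  | ere : Rel k (freeE 0 * freeR 1 * freeE 0) (freeE 0)
  | errre : Rel k (freeE 0 * freeR 1 * freeR 0 * freeR 1 * freeE 0) (freeE 0)
  | h4 (h : k = 4) : Rel k
      (freeE 0 * (freeR 1 * freeR 0 * freeR 1 * freeR 0 * freeR 2 * freeR 1 * freeR 0 * freeR 1 *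
        freeR 2 * freeR 0 * freeR 1 * freeR 0 * freeR 1 * freeR 2 * freeR 3) ^ 5)
      (freeE 0)

/-- The Brauer algebra `Br(H_k)` over `ℤ[δ^{±1}]`. -/
abbrev Br (k : ℕ) [NeZero k] : Type := RingQuot (Rel k)

/-- The generator `r_i` of `Br(H_k)`. -/
noncomputable def r {k : ℕ} [NeZero k] (i : Fin k) : Br k :=
  RingQuot.mkAlgHom Scalars (Rel k) (freeR i)

/-- The generator `e_i` of `Br(H_k)`. -/
noncomputable def e {k : ℕ} [NeZero k] (i : Fin k) : Br k :=
  RingQuot.mkAlgHom Scalars (Rel k) (freeE i)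

/-- The Brauer monoid `BrM(H_k)`: the multiplicative submonoid of `Br(H_k)` generated by `δ` and
all `r_i`, `e_i`. -/
noncomputable def BrM (k : ℕ) [NeZero k] : Submonoid (Br k) :=
  Submonoid.closure ({algebraMap Scalars (Br k) (deltaPow 1)} ∪ Set.range r ∪ Set.range e)

section lifting

variable {A : Type*} [Monoid A]

theorem pow_three_of_braid {a b : A} (ha : a * a = 1) (hb : b * b = 1)
    (h : a * b * a = b * a * b) : (a * b) ^ 3 = 1 := by
  calc (a * b) ^ 3 = (a * b * a) * (b * a * b) := by simp only [pow_succ, pow_zero, one_mul, mul_assoc]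
    _ = (a * b * a) * (a * b * a) := by rw [h]
    _ = a * (b * (a * a) * b) * a := by simp only [mul_assoc]
    _ = 1 := by simp [ha, hb]

theorem pow_five_of_braid {a b : A} (ha : a * a = 1) (hb : b * b = 1)
    (h : a * b * a * b * a = b * a * b * a * b) : (a * b) ^ 5 = 1 := by
  calc (a * b) ^ 5 = (a * b * a * b * a) * (b * a * b * a * b) := by
        simp only [pow_succ, pow_zero, one_mul, mul_assoc]
    _ = (a * b * a * b * a) * (a * b * a * b * a) := by rw [h]
    _ = a * (b * (a * (b * (a * a) * b) * a) * b) * a := by simp only [mul_assoc]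
    _ = 1 := by simp [ha, hb]

theorem isLiftable_of_braid (k : ℕ) (f : Fin k → A) (sq : ∀ i, f i * f i = 1)
    (h2 : ∀ i j, hMatrix k i j = 2 → f i * f j = f j * f i)
    (h3 : ∀ i j, hMatrix k i j = 3 → f i * f j * f i = f j * f i * f j)
    (h5 : ∀ i j, i.val = 0 → j.val = 1 →
      f i * f j * f i * f j * f i = f j * f i * f j * f i * f j) :
    (hMatrix k).IsLiftable f := by
  intro i j
  by_cases hij : i = j
  · subst hij
    simp [hMatrix, sq]
  by_cases hs : i.val + j.val = 1
  · have hm : hMatrix k i j = 5 := by simp [hMatrix, hij, hs]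
    have hm' : (hMatrix k).M i j = 5 := hm
    rw [hm']
    apply pow_five_of_braid (sq i) (sq j)
    rcases (by omega : (i.val = 0 ∧ j.val = 1) ∨ (j.val = 0 ∧ i.val = 1)) with h | h
    · exact h5 i j h.1 h.2
    · exact (h5 j i h.1 h.2).symm
  by_cases ha : i.val + 1 = j.val ∨ j.val + 1 = i.val
  · have hm : hMatrix k i j = 3 := by simp [hMatrix, hij, hs, ha]
    have hm' : (hMatrix k).M i j = 3 := hm
    rw [hm']
    exact pow_three_of_braid (sq i) (sq j) (h3 i j hm)
  · have hm : hMatrix k i j = 2 := by simp [hMatrix, hij, hs, ha]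
    have hm' : (hMatrix k).M i j = 2 := hm
    rw [hm', pow_two, mul_assoc, ← mul_assoc (f j), ← h2 i j hm, mul_assoc, sq j, mul_one, sq i]

end lifting

theorem r_def {k : ℕ} [NeZero k] (i : Fin k) :
    (r i : Br k) = RingQuot.mkAlgHom Scalars (Rel k) (freeR i) := rfl

theorem r_isLiftable (k : ℕ) [NeZero k] : (hMatrix k).IsLiftable (r : Fin k → Br k) := by
  have rel : ∀ {x y : FreeAlgebra Scalars (Gen k)}, Rel k x y →
      RingQuot.mkAlgHom Scalars (Rel k) x = RingQuot.mkAlgHom Scalars (Rel k) y :=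
    fun h => RingQuot.mkAlgHom_rel Scalars h
  apply isLiftable_of_braid
  · intro i
    simpa only [map_mul, map_one, ← r_def] using rel (Rel.r_sq i)
  · intro i j h
    simpa only [map_mul, ← r_def] using rel (Rel.comm_rr i j h)
  · intro i j h
    simpa only [map_mul, ← r_def] using rel (Rel.braid3 i j h)
  · intro i j hi hj
    have hk : 1 < k := hj ▸ j.isLt
    obtain rfl : i = 0 := Fin.ext (by simp [hi])
    obtain rfl : j = 1 := Fin.ext (by simp [hj, Nat.mod_eq_of_lt hk])
    simpa only [map_mul, ← r_def] using rel Rel.braid5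

/-- The natural monoid homomorphism `W(H_k) → Br(H_k)` that sends the simple reflections to the
generators `r_i`. -/
noncomputable def toBr (k : ℕ) [NeZero k] : W k →* Br k :=
  (hMatrix k).toCoxeterSystem.lift ⟨r, r_isLiftable k⟩

/-! ### Roots and stabilizers -/

/-- The real space spanned by the simple roots, in coordinates with respect to them. -/
abbrev V (k : ℕ) : Type := Fin k → ℝ

/-- The simple roots. -/
noncomputable def simpleRoot {k : ℕ} (i : Fin k) : V k := Pi.single i 1

/-- The Gram matrix of the simple roots (all of squared length `2`). -/
noncomputable def gram (k : ℕ) : Matrix (Fin k) (Fin k) ℝ := fun i j =>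
  if hMatrix k i j = 1 then 2
  else if hMatrix k i j = 5 then -Real.goldenRatio
  else if hMatrix k i j = 3 then -1
  else 0

/-- The inner product on the space spanned by the roots. -/
noncomputable def ip (k : ℕ) : LinearMap.BilinForm ℝ (V k) := Matrix.toBilin' (gram k)

/-- The reflection `v ↦ v - (v, b) b` in a vector `b` of squared length `2`. -/
noncomputable def reflection {k : ℕ} (b : V k) : Module.End ℝ (V k) :=
  LinearMap.id - ((ip k).flip b).smulRight b

theorem reflection_apply {k : ℕ} (b v : V k) : reflection b v = v - ip k v b • b := by
  simp [reflection]

theorem ip_simple {k : ℕ} (i j : Fin k) : ip k (simpleRoot i) (simpleRoot j) = gram k i j := by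
  simp [ip, simpleRoot, Matrix.toBilin'_single]

set_option linter.unusedSimpArgs false in
theorem reflection_isLiftable (k : ℕ) :
    (hMatrix k).IsLiftable (fun i => reflection (simpleRoot i) : Fin k → Module.End ℝ (V k)) := by
  have hd : ∀ i : Fin k, gram k i i = 2 := fun i => by simp [gram, hMatrix]
  have hsymm : ∀ i j : Fin k, gram k j i = gram k i j := fun i j => by
    simp only [gram, (hMatrix k).symmetric i j]
  have h2 : Real.goldenRatio ^ 2 = Real.goldenRatio + 1 := Real.goldenRatio_sq
  have h3 : Real.goldenRatio ^ 3 = 2 * Real.goldenRatio + 1 := by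
    linear_combination (Real.goldenRatio + 1) * h2
  have h4 : Real.goldenRatio ^ 4 = 3 * Real.goldenRatio + 2 := by
    linear_combination (Real.goldenRatio ^ 2 + Real.goldenRatio + 2) * h2
  apply isLiftable_of_braid
  · intro i
    refine LinearMap.ext fun v => ?_
    simp only [Module.End.mul_apply, Module.End.one_apply, reflection_apply, map_sub, map_smul,
      LinearMap.sub_apply, LinearMap.smul_apply, ip_simple, hd, smul_eq_mul]
    module
  · intro i j h
    have hg : gram k i j = 0 := by simp [gram, h]
    refine LinearMap.ext fun v => ?_
    simp only [Module.End.mul_apply, reflection_apply, map_sub, map_smul,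
      LinearMap.sub_apply, LinearMap.smul_apply, ip_simple, hd, hsymm i j, hg, smul_eq_mul]
    module
  · intro i j h
    have hg : gram k i j = -1 := by simp [gram, h]
    refine LinearMap.ext fun v => ?_
    simp only [Module.End.mul_apply, reflection_apply, map_sub, map_smul,
      LinearMap.sub_apply, LinearMap.smul_apply, ip_simple, hd, hsymm i j, hg, smul_eq_mul]
    module
  · intro i j hi hj
    have hm : hMatrix k i j = 5 := by
      have : i ≠ j := fun hh => by omega
      simp [hMatrix, this, hi, hj]
    have hg : gram k i j = -Real.goldenRatio := by simp [gram, hm]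
    refine LinearMap.ext fun v => ?_
    simp only [Module.End.mul_apply, reflection_apply, map_sub, map_smul,
      LinearMap.sub_apply, LinearMap.smul_apply, ip_simple, hd, hsymm i j, hg, smul_eq_mul]
    clear hg
    generalize Real.goldenRatio = φ at h2 h3 h4 ⊢
    match_scalars <;> ring_nf <;> (try simp only [h2, h3, h4]) <;> ring

/-- The action of `W(H_k)` on the space spanned by the roots, in which the simple reflections of
the group act as the reflections in the simple roots. -/
noncomputable def geom (k : ℕ) : W k →* Module.End ℝ (V k) :=
  (hMatrix k).toCoxeterSystem.lift ⟨fun i => reflection (simpleRoot i), reflection_isLiftable k⟩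

/-- The stabilizer in `W(H_k)` of a set `B` of positive roots, for the action on positive roots in
which negative roots are negated: the elements `w` that permute `B ∪ -B`. -/
noncomputable def rootStabilizer {k : ℕ} (B : Set (V k)) : Subgroup (W k) where
  carrier := {w | geom k w '' (B ∪ -B) = B ∪ -B}
  one_mem' := by simp
  mul_mem' {a b} ha hb := by
    simp only [Set.mem_ofPred_eq] at ha hb ⊢
    rw [map_mul, Module.End.mul_eq_comp, LinearMap.coe_comp, Set.image_comp, hb, ha]
  inv_mem' {a} ha := by
    simp only [Set.mem_ofPred_eq] at ha ⊢
    conv_lhs => rw [← ha]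
    rw [← Set.image_comp, ← LinearMap.coe_comp, ← Module.End.mul_eq_comp, ← map_mul]
    simp

/-- The positive root `β₅ = φ² β₁ + 2φ β₂ + φ β₃`, orthogonal to `β₁` and `β₃`. -/
noncomputable def beta5 (k : ℕ) [NeZero k] : V k :=
  Real.goldenRatio ^ 2 • simpleRoot 0 + (2 * Real.goldenRatio) • simpleRoot 1 +
    Real.goldenRatio • simpleRoot 2

/-- The reflection `r₅` in `β₅`, as an element of the Coxeter group:
the conjugate of `r₁` by `r₂r₁r₂r₁r₃r₂`, which maps `β₁` to `β₅`. -/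
def r5 (k : ℕ) [NeZero k] : W k :=
  (s 1 * s 0 * s 1 * s 0 * s 2 * s 1) * s 0 * (s 1 * s 0 * s 1 * s 0 * s 2 * s 1)⁻¹

/-- The positive root `β₇ = φ² β₅ + 2φ β₄ + φ β₃` of type `H₄`: the root orthogonal to `β₃` and
`β₅` in the root system of type `H₃` with simple roots `β₅`, `β₄`, `β₃`. -/
noncomputable def beta7 : V 4 :=
  Real.goldenRatio ^ 2 • beta5 4 + (2 * Real.goldenRatio) • simpleRoot 3 +
    Real.goldenRatio • simpleRoot 2

/-! ### Normal forms -/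

/-- `D` is a set of representatives of the left cosets of `K` in `H`. -/
def IsLeftTransversal {G : Type*} [Group G] (D : Set G) (K H : Subgroup G) : Prop :=
  D ⊆ H ∧ ∀ x ∈ H, ∃! d, d ∈ D ∧ d⁻¹ * x ∈ K

/-- Formal expressions of the three types `r`, `u e₁ v w` and `u e₁ e₃ w`. -/
inductive Form (k : ℕ) : Type
  | typeI (r : W k) : Form k
  | typeII (u v w : W k) : Form k
  | typeIII (u w : W k) : Form k

/-- The element of `Br(H_k)` given by a formal expression. -/
noncomputable def Form.eval {k : ℕ} [NeZero k] : Form k → Br k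
  | typeI r => toBr k r
  | typeII u v w => toBr k u * e 0 * toBr k v * toBr k w
  | typeIII u w => toBr k u * e 0 * e 2 * toBr k w

/-- The normal forms for given sets of representatives. -/
def normalForms {k : ℕ} (D₁ C₁ D₂ : Set (W k)) : Set (Form k) :=
  {f | match f with
    | .typeI _ => True
    | .typeII u v w => u ∈ D₁ ∧ v ∈ C₁ ∧ w⁻¹ ∈ D₁
    | .typeIII u w => u ∈ D₂ ∧ w⁻¹ ∈ D₂}

end BrauerH

/-! Write N for the stabilizer of ±β₁. Every eᵢ is conjugate to e₁ under the group, so building a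
monoid element from the right comes down to one question: what does left multiplication by e₁ do to
an element of each of the three types?

For e₁ w e₁ the answer depends only on the double coset N w N, because N commutes with e₁;
equivalently, on the N-orbit of ±wβ₁. If wβ₁ is not orthogonal to β₁, the orbit contains a root for
which e₁² = δ²e₁, e₁r₂e₁ = e₁, e₁r₂r₁r₂e₁ = e₁ or a conjugate of e₃r₂e₃ = e₃ evaluates the product
inside δ^ℤ W e₁. If wβ₁ is orthogonal to β₁, the product lies in W e₁e₃ W. This is `IsH.collapses`.

For e₁ u e₁e₃, the element e₁e₃ absorbs a group that carries β₁ to β₃, β₅ (and β₇ for k = 4). With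
β₁ these roots form a basis, so u⁻¹β₁ is not orthogonal to all of them. Replacing u by uκ with a
suitable absorbed κ leads back to the non-orthogonal case, and the product stays of the third type
(`isReduced_of_mem`).

Restricting the group elements to coset representatives then uses N = C ∪ C r₁, where C fixes β₁:
the N-parts of u and w meet at e₁, which absorbs r₁ and leaves one element of C. For k = 4 the extra
defining relation also removes the central element of C. In the third type the N₂-parts are absorbed
on both sides (`exists_normalForm`).

These arguments need generators for the stabilizers. They come from the fact that the stabilizer of
a dominant vector is generated by simple reflections (`FiniteRoots.mem_closure_of_dominant`). That
fact and the faithfulness of the reflection action rest on confluence of descent in the weak order.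
Statements about individual roots are evaluated on a table of the positive roots, and group orders
follow by counting orbits. -/

namespace BrauerH

/-! ### Descent in the weak order, faithfulness and stabilizers of dominant vectors -/

section descent

variable {k : ℕ}

theorem geom_s (i : Fin k) : geom k (s i) = reflection (simpleRoot i) :=
  (hMatrix k).toCoxeterSystem.lift_apply_simple (reflection_isLiftable k) i

theorem s_mul_s (i : Fin k) : (s i : W k) * s i = 1 :=
  (hMatrix k).toCoxeterSystem.simple_mul_simple_self i

theorem s_inv (i : Fin k) : (s i : W k)⁻¹ = s i :=
  (hMatrix k).toCoxeterSystem.inv_simple i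

theorem closure_range_s (k : ℕ) : Subgroup.closure (Set.range (s : Fin k → W k)) = ⊤ :=
  (hMatrix k).toCoxeterSystem.subgroup_closure_range_simple

theorem geom_mul_apply (w w' : W k) (v : V k) : geom k (w * w') v = geom k w (geom k w' v) := by
  rw [map_mul]; rfl

theorem geom_inv_apply (w : W k) (v : V k) : geom k w⁻¹ (geom k w v) = v := by
  rw [← geom_mul_apply]; simp

theorem geom_apply_inv (w : W k) (v : V k) : geom k w (geom k w⁻¹ v) = v := by
  rw [← geom_mul_apply]; simp

theorem geom_injective (w : W k) : Function.Injective (geom k w) :=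
  Function.LeftInverse.injective (geom_inv_apply w)

theorem gram_self (i : Fin k) : gram k i i = 2 := by simp [gram, hMatrix]

theorem gram_comm (i j : Fin k) : gram k i j = gram k j i := by
  simp only [gram, (hMatrix k).symmetric i j]

theorem ip_comm (v w : V k) : ip k v w = ip k w v := by
  have : (gram k).IsSymm := Matrix.IsSymm.ext fun i j => gram_comm _ _
  simp only [ip, Matrix.toBilin'_apply']
  rw [Matrix.dotProduct_mulVec, ← Matrix.mulVec_transpose, this, dotProduct_comm]

theorem geom_mul_s_self (w : W k) (i : Fin k) :
    geom k (w * s i) (simpleRoot i) = - geom k w (simpleRoot i) := by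
  rw [geom_mul_apply, geom_s, reflection_apply, ip_simple, gram_self, ← map_neg]
  congr 1
  module

theorem geom_mul_s (w : W k) (i j : Fin k) :
    geom k (w * s i) (simpleRoot j) =
      geom k w (simpleRoot j) - gram k j i • geom k w (simpleRoot i) := by
  rw [geom_mul_apply, geom_s, reflection_apply, ip_simple, map_sub, map_smul]

theorem geom_simpleRoot_ne_zero (w : W k) (i : Fin k) : geom k w (simpleRoot i) ≠ 0 := by
  intro h
  have h2 : (simpleRoot i : V k) = 0 := geom_injective w (by rw [h, map_zero])
  have := congrFun h2 i
  simp [simpleRoot] at this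

theorem ip_geom (w : W k) (u v : V k) : ip k (geom k w u) (geom k w v) = ip k u v := by
  induction w using (hMatrix k).toCoxeterSystem.simple_induction generalizing u v with
  | simple i =>
    change ip k (geom k (s i) u) (geom k (s i) v) = _
    simp only [geom_s, reflection_apply, map_sub, map_smul, LinearMap.sub_apply,
      LinearMap.smul_apply, ip_simple, gram_self, smul_eq_mul, ip_comm (simpleRoot i) v]
    ring
  | one => simp
  | mul a b ha hb => rw [geom_mul_apply, geom_mul_apply, ha, hb]

theorem geom_ext {w w' : W k} (h : ∀ i, geom k w (simpleRoot i) = geom k w' (simpleRoot i)) :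
    geom k w = geom k w' := by
  refine LinearMap.pi_ext' fun i => LinearMap.ext_ring ?_
  simpa [simpleRoot] using h i

/-- One step down the weak order, as seen by the action on the simple roots. -/
def Step (w u : W k) : Prop := ∃ i, geom k w (simpleRoot i) ≤ 0 ∧ u = w * s i

theorem braid_cases {i j : Fin k} (h : i ≠ j) :
    ((s i * s j : W k) = s j * s i ∧ gram k i j = 0) ∨
    ((s i * s j * s i : W k) = s j * s i * s j ∧ gram k i j = -1) ∨
    ((s i * s j * s i * s j * s i : W k) = s j * s i * s j * s i * s j ∧
      gram k i j = -Real.goldenRatio) := by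
  have hp := (hMatrix k).toCoxeterSystem.simple_mul_simple_pow i j
  change (s i * s j : W k) ^ (hMatrix k i j) = 1 at hp
  have hM : hMatrix k i j = 2 ∨ hMatrix k i j = 3 ∨ hMatrix k i j = 5 := by
    change (if i = j then 1 else if i.val + j.val = 1 then 5
      else if i.val + 1 = j.val ∨ j.val + 1 = i.val then 3 else 2) = _ ∨
      (if i = j then 1 else if i.val + j.val = 1 then 5
      else if i.val + 1 = j.val ∨ j.val + 1 = i.val then 3 else 2) = _ ∨
      (if i = j then 1 else if i.val + j.val = 1 then 5
      else if i.val + 1 = j.val ∨ j.val + 1 = i.val then 3 else 2) = _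
    rw [if_neg h]; split_ifs <;> simp
  rcases hM with hM | hM | hM <;> rw [hM] at hp
  · refine Or.inl ⟨?_, by simp [gram, hM]⟩
    rw [← mul_inv_eq_one]
    simpa [s_inv, pow_succ, mul_assoc] using hp
  · refine Or.inr (Or.inl ⟨?_, by simp [gram, hM]⟩)
    rw [← mul_inv_eq_one]
    simpa [s_inv, pow_succ, mul_assoc] using hp
  · refine Or.inr (Or.inr ⟨?_, by simp [gram, hM]⟩)
    rw [← mul_inv_eq_one]
    simpa [s_inv, pow_succ, mul_assoc] using hp

/-- Both chains continue inside the dihedral group ⟨sᵢ, sⱼ⟩ to w times its longest element. The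
roots met on the way are non-negative combinations of wαᵢ and wαⱼ, hence ≤ 0, so every move is a
legal step. -/
theorem step_diamond {w : W k} {i j : Fin k} (hi : geom k w (simpleRoot i) ≤ 0)
    (hj : geom k w (simpleRoot j) ≤ 0) :
    ∃ u, Relation.ReflTransGen Step (w * s i) u ∧ Relation.ReflTransGen Step (w * s j) u := by
  by_cases h : i = j
  · subst h; exact ⟨_, .refl, .refl⟩
  have step : ∀ (u : W k) (i : Fin k), geom k u (simpleRoot i) ≤ 0 →
    Relation.ReflTransGen Step u (u * s i) := fun u i h => .single ⟨i, h, rfl⟩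
  rcases braid_cases h with ⟨hb, hg⟩ | ⟨hb, hg⟩ | ⟨hb, hg⟩
  · refine ⟨w * s i * s j, step _ _ ?_, ?_⟩
    · rwa [geom_mul_s, gram_comm, hg, zero_smul, sub_zero]
    · rw [mul_assoc, hb, ← mul_assoc]
      apply step
      rwa [geom_mul_s, hg, zero_smul, sub_zero]
  · have key : ∀ i j : Fin k, gram k i j = -1 → geom k w (simpleRoot i) ≤ 0 →
        geom k w (simpleRoot j) ≤ 0 →
        Relation.ReflTransGen Step (w * s i) (w * (s i * s j * s i)) := by
      intro i j hg hi hj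
      have e1 : geom k (w * s i) (simpleRoot j) =
          geom k w (simpleRoot i) + geom k w (simpleRoot j) := by
        rw [geom_mul_s, gram_comm, hg]; module
      have e2 : geom k (w * s i * s j) (simpleRoot i) = geom k w (simpleRoot j) := by
        rw [geom_mul_s, e1, geom_mul_s_self, hg]; module
      simp only [← mul_assoc]
      refine (step _ j ?_).trans (step _ i ?_)
      · rw [e1]; exact add_nonpos hi hj
      · rw [e2]; exact hj
    exact ⟨_, key i j hg hi hj, hb ▸ key j i (gram_comm i j ▸ hg) hj hi⟩
  -- The coefficient pairs (φ, 1), (φ, φ), (1, φ), (0, 1) in `e1` to `e4` run through the remaining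
  -- positive roots of the dihedral system of order ten. The golden ratio is replaced by a variable
  -- φ known only through φ² = φ + 1 and positivity.
  · have key : ∀ φ : ℝ, φ ^ 2 = φ + 1 → 0 < φ → ∀ i j : Fin k, gram k i j = -φ →
        geom k w (simpleRoot i) ≤ 0 →
        geom k w (simpleRoot j) ≤ 0 →
        Relation.ReflTransGen Step (w * s i) (w * (s i * s j * s i * s j * s i)) := by
      intro φ hφ hpos i j hg hi hj
      have e1 : geom k (w * s i) (simpleRoot j) =
          φ • geom k w (simpleRoot i) + geom k w (simpleRoot j) := by
        rw [geom_mul_s, gram_comm, hg]; module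
      have e2 : geom k (w * s i * s j) (simpleRoot i) =
          φ • geom k w (simpleRoot i) +
            φ • geom k w (simpleRoot j) := by
        rw [geom_mul_s, e1, geom_mul_s_self, hg]
        match_scalars <;> first | ring1 | linear_combination hφ
      have e3 : geom k (w * s i * s j * s i) (simpleRoot j) =
          geom k w (simpleRoot i) + φ • geom k w (simpleRoot j) := by
        rw [geom_mul_s, e2, geom_mul_s_self, e1, gram_comm, hg]
        match_scalars <;> first | ring1 | linear_combination hφ
      have e4 : geom k (w * s i * s j * s i * s j) (simpleRoot i) = geom k w (simpleRoot j) := by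
        rw [geom_mul_s, e3, geom_mul_s_self, e2, hg]
        match_scalars <;> first | ring1 | linear_combination hφ
      simp only [← mul_assoc]
      have smul_np : ∀ {v : V k}, v ≤ 0 → φ • v ≤ 0 := fun hv =>
        smul_nonpos_of_nonneg_of_nonpos hpos.le hv
      refine (((step _ j ?_).trans (step _ i ?_)).trans (step _ j ?_)).trans (step _ i ?_)
      · rw [e1]; exact add_nonpos (smul_np hi) hj
      · rw [e2]; exact add_nonpos (smul_np hi) (smul_np hj)
      · rw [e3]; exact add_nonpos hi (smul_np hj)
      · rw [e4]; exact hj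
    have key' := key _ Real.goldenRatio_sq Real.goldenRatio_pos
    exact ⟨_, key' i j hg hi hj, hb ▸ key' j i (gram_comm i j ▸ hg) hj hi⟩

/-- The properties of a finite root system on which the arguments below rest. -/
structure FiniteRoots (k : ℕ) : Prop where
  nonneg_or_nonpos (w : W k) (i : Fin k) :
    0 ≤ geom k w (simpleRoot i) ∨ geom k w (simpleRoot i) ≤ 0
  finite : (Set.range fun p : W k × Fin k => geom k p.1 (simpleRoot p.2)).Finite
  dominant : ∃ c : V k, ∀ i, 0 < ip k c (simpleRoot i)

namespace FiniteRoots

/-- For c in the open fundamental chamber, a step replaces wc by wc - (c, αᵢ) wαᵢ with wαᵢ ≤ 0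
nonzero, so the coordinate sum of wc strictly increases. It takes finitely many values, and the
measure counts the values still above the current one. -/
theorem exists_measure (H : FiniteRoots k) : ∃ μ : W k → ℕ, ∀ w u, Step w u → μ u < μ w := by
  obtain ⟨c, hc⟩ := H.dominant
  let ht : V k →ₗ[ℝ] ℝ := ∑ i, LinearMap.proj i
  let F : W k → ℝ := fun w => ht (geom k w c)
  have hF : (Set.range F).Finite := by
    have h1 : (Set.univ.pi fun _ : Fin k =>
        Set.range fun p : W k × Fin k => geom k p.1 (simpleRoot p.2)).Finite :=
      Set.Finite.pi fun _ => H.finite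
    refine (h1.image fun f : Fin k → V k => ht (∑ i, c i • f i)).subset ?_
    rintro _ ⟨w, rfl⟩
    refine ⟨fun i => geom k w (simpleRoot i), fun i _ => ⟨(w, i), rfl⟩, ?_⟩
    have : c = ∑ i, c i • (simpleRoot i : V k) := by
      ext j; simp [simpleRoot, Pi.single_apply]
    change ht _ = ht _
    conv_rhs => rw [this, map_sum]
    simp only [map_smul]
  refine ⟨fun w => (hF.toFinset.filter (F w < ·)).card, ?_⟩
  rintro w _ ⟨i, hi, rfl⟩
  have hlt : F w < F (w * s i) := by
    have e : F (w * s i) = F w - ip k c (simpleRoot i) * ht (geom k w (simpleRoot i)) := by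
      simp only [F]
      rw [geom_mul_apply, geom_s, reflection_apply, map_sub, map_smul, map_sub, map_smul,
        smul_eq_mul]
    have hneg : ht (geom k w (simpleRoot i)) < 0 := by
      simp only [ht, LinearMap.sum_apply, LinearMap.proj_apply]
      refine lt_of_le_of_ne (Finset.sum_nonpos fun j _ => hi j) fun h0 => ?_
      apply geom_simpleRoot_ne_zero w i
      rw [Finset.sum_eq_zero_iff_of_nonpos fun j _ => hi j] at h0
      exact funext fun j => h0 j (Finset.mem_univ j)
    rw [e]
    nlinarith [hc i]
  apply Finset.card_lt_card
  rw [Finset.ssubset_iff_of_subset]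
  · exact ⟨F (w * s i), by simp [hlt], by simp⟩
  · intro x hx
    simp only [Finset.mem_filter] at hx ⊢
    exact ⟨hx.1, hlt.trans hx.2⟩

/-- This is the argument of Newman's lemma: termination and the local diamond replace the length
function and the exchange condition. -/
theorem reaches_one (H : FiniteRoots k) (w : W k) : Relation.ReflTransGen Step w 1 := by
  obtain ⟨μ, hμ⟩ := H.exists_measure
  have hle : ∀ {w u}, Relation.ReflTransGen Step w u → μ u ≤ μ w := by
    intro w u h
    induction h with
    | refl => rfl
    | tail _ h ih => exact (hμ _ _ h).le.trans ih
  -- Reaching 1 passes to every one-step successor. The given path from w starts with some w sⱼ; the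
  -- diamond joins it to u at t, and the induction hypothesis carries the property along the path
  -- from w sⱼ to t.
  have down : ∀ n (w u : W k), μ w < n → Relation.ReflTransGen Step w 1 → Step w u →
      Relation.ReflTransGen Step u 1 := by
    intro n
    induction n with
    | zero => intro w u h; omega
    | succ n ih =>
      rintro w u hw hgood ⟨i, hi, rfl⟩
      rcases hgood.cases_head with rfl | ⟨v, ⟨j, hj, rfl⟩, hv⟩
      · exfalso
        rw [map_one] at hi
        have := hi i
        norm_num [simpleRoot] at this
      · obtain ⟨t, hit, hjt⟩ := step_diamond hi hj
        have hvw := hμ _ _ ⟨j, hj, rfl⟩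
        have : Relation.ReflTransGen Step t 1 := by
          clear hit
          induction hjt with
          | refl => exact hv
          | @tail b c hb hc ih' => exact ih b c (by have := hle hb; omega) ih' hc
        exact hit.trans this
  induction w using (hMatrix k).toCoxeterSystem.simple_induction_right with
  | one => exact .refl
  | mul_simple_right w i ih =>
    change Relation.ReflTransGen Step (w * s i) 1
    rcases H.nonneg_or_nonpos w i with h | h
    · refine .head ⟨i, ?_, ?_⟩ ih
      · rw [geom_mul_s_self]; simpa using h
      · rw [mul_assoc, s_mul_s, mul_one]
    · exact down _ w _ (Nat.lt_succ_self _) ih ⟨i, h, rfl⟩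

theorem descent_induction (H : FiniteRoots k) {P : W k → Prop} (one : P 1)
    (step : ∀ w i, geom k w (simpleRoot i) ≤ 0 → P (w * s i) → P w) (w : W k) : P w := by
  have h := H.reaches_one w
  induction h using Relation.ReflTransGen.head_induction_on with
  | refl => exact one
  | head h _ ih =>
    obtain ⟨i, hi, rfl⟩ := h
    exact step _ i hi ih

/-- An element that acts trivially makes no simple root negative, so no step leaves it and the path
to 1 has length zero. -/
theorem eq_one_of_geom_eq_one (H : FiniteRoots k) {w : W k} (h : geom k w = 1) : w = 1 := by
  rcases (H.reaches_one w).cases_head with h1 | ⟨_, ⟨i, hi, -⟩, -⟩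
  · exact h1
  · have := hi i
    rw [h] at this
    norm_num [simpleRoot] at this

theorem faithful (H : FiniteRoots k) : Function.Injective (geom k) := by
  intro w w' h
  rw [← mul_inv_eq_one]
  apply H.eq_one_of_geom_eq_one
  rw [map_mul, h, ← map_mul, mul_inv_cancel, map_one]

theorem ext (H : FiniteRoots k) {w w' : W k}
    (h : ∀ i, geom k w (simpleRoot i) = geom k w' (simpleRoot i)) : w = w' :=
  H.faithful (geom_ext h)

theorem ip_nonpos {v : V k} (hv : ∀ i, 0 ≤ ip k v (simpleRoot i)) {u : V k} (hu : u ≤ 0) :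
    ip k v u ≤ 0 := by
  have : u = ∑ i, u i • (simpleRoot i : V k) := by
    ext j; simp [simpleRoot, Pi.single_apply]
  rw [this, map_sum]
  refine Finset.sum_nonpos fun i _ => ?_
  rw [map_smul, smul_eq_mul]
  exact mul_nonpos_of_nonpos_of_nonneg (hu i) (hv i)

/-- The stabilizer of a dominant vector is generated by the simple reflections it contains. -/
theorem mem_closure_of_dominant (H : FiniteRoots k) {v : V k}
    (hv : ∀ i, 0 ≤ ip k v (simpleRoot i)) (w : W k) (hw : geom k w v = v) :
    w ∈ Subgroup.closure (s '' {i : Fin k | ip k v (simpleRoot i) = 0}) := by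
  revert hw
  refine H.descent_induction (P := fun w => geom k w v = v →
      w ∈ Subgroup.closure (s '' {i : Fin k | ip k v (simpleRoot i) = 0}))
    (fun _ => Subgroup.one_mem _) ?_ w
  intro w i hi ih hw
  -- Invariance gives (v, αᵢ) = (wv, wαᵢ) = (v, wαᵢ), which is ≤ 0 because v is dominant and wαᵢ ≤
  -- 0.
  have h0 : ip k v (simpleRoot i) = 0 := by
    refine le_antisymm ?_ (hv i)
    rw [← ip_geom w, hw]
    exact ip_nonpos hv hi
  have hs : geom k (w * s i) v = v := by
    rw [geom_mul_apply, geom_s, reflection_apply, h0, zero_smul, sub_zero, hw]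
  have := Subgroup.mul_mem _ (ih hs) (Subgroup.subset_closure ⟨i, h0, rfl⟩)
  rwa [mul_assoc, s_mul_s, mul_one] at this

end FiniteRoots

end descent

/-! ### The table of positive roots -/

section table

/-- The positive roots of type `H₄` in coordinates with respect to the simple roots, where `(a, b)`
stands for `a + b φ`. The first 15 are those of type `H₃`. -/
def rootTable : List (List (ℕ × ℕ)) := [
  [(1, 0), (0, 0), (0, 0), (0, 0)], [(0, 0), (1, 0), (0, 0), (0, 0)],
  [(0, 0), (0, 0), (1, 0), (0, 0)], [(1, 0), (0, 1), (0, 0), (0, 0)],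
  [(0, 1), (1, 0), (0, 0), (0, 0)], [(0, 0), (1, 0), (1, 0), (0, 0)],
  [(0, 1), (0, 1), (0, 0), (0, 0)], [(1, 0), (0, 1), (0, 1), (0, 0)],
  [(0, 1), (1, 0), (1, 0), (0, 0)], [(0, 1), (0, 1), (0, 1), (0, 0)],
  [(0, 1), (1, 1), (1, 0), (0, 0)], [(0, 1), (1, 1), (0, 1), (0, 0)],
  [(1, 1), (1, 1), (1, 0), (0, 0)], [(1, 1), (1, 1), (0, 1), (0, 0)],
  [(1, 1), (0, 2), (0, 1), (0, 0)], [(0, 0), (0, 0), (0, 0), (1, 0)],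
  [(0, 0), (0, 0), (1, 0), (1, 0)], [(0, 0), (1, 0), (1, 0), (1, 0)],
  [(1, 0), (0, 1), (0, 1), (0, 1)], [(0, 1), (1, 0), (1, 0), (1, 0)],
  [(0, 1), (0, 1), (0, 1), (0, 1)], [(0, 1), (1, 1), (1, 0), (1, 0)],
  [(0, 1), (1, 1), (0, 1), (0, 1)], [(1, 1), (1, 1), (1, 0), (1, 0)],
  [(1, 1), (1, 1), (0, 1), (0, 1)], [(1, 1), (0, 2), (0, 1), (0, 1)],
  [(0, 1), (1, 1), (1, 1), (1, 0)], [(0, 1), (1, 1), (1, 1), (0, 1)],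
  [(1, 1), (1, 1), (1, 1), (1, 0)], [(1, 1), (1, 1), (1, 1), (0, 1)],
  [(1, 1), (0, 2), (0, 2), (0, 1)], [(1, 1), (1, 2), (1, 1), (1, 0)],
  [(1, 1), (1, 2), (1, 1), (0, 1)], [(1, 1), (1, 2), (0, 2), (0, 1)],
  [(1, 2), (1, 2), (1, 1), (1, 0)], [(1, 2), (1, 2), (1, 1), (0, 1)],
  [(1, 2), (1, 2), (0, 2), (0, 1)], [(1, 2), (2, 2), (1, 1), (1, 0)],
  [(1, 2), (2, 2), (1, 1), (0, 1)], [(1, 2), (1, 3), (0, 2), (0, 1)],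
  [(1, 2), (2, 2), (2, 1), (1, 0)], [(1, 2), (2, 2), (1, 2), (0, 1)],
  [(2, 2), (1, 3), (0, 2), (0, 1)], [(1, 2), (1, 3), (1, 2), (0, 1)],
  [(1, 2), (2, 2), (2, 1), (1, 1)], [(1, 2), (2, 2), (1, 2), (1, 1)],
  [(2, 2), (1, 3), (1, 2), (0, 1)], [(1, 2), (1, 3), (1, 2), (1, 1)],
  [(2, 2), (2, 3), (1, 2), (0, 1)], [(2, 2), (1, 3), (1, 2), (1, 1)],
  [(1, 3), (2, 3), (1, 2), (0, 1)], [(2, 2), (2, 3), (1, 2), (1, 1)],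
  [(1, 3), (2, 3), (1, 2), (1, 1)], [(2, 2), (2, 3), (2, 2), (1, 1)],
  [(1, 3), (2, 3), (2, 2), (1, 1)], [(1, 3), (3, 3), (2, 2), (1, 1)],
  [(2, 3), (3, 3), (2, 2), (1, 1)], [(2, 3), (2, 4), (2, 2), (1, 1)],
  [(2, 3), (2, 4), (1, 3), (1, 1)], [(2, 3), (2, 4), (1, 3), (0, 2)]]

/-- The permutations of the positive roots, up to sign, by the simple reflections. -/
def permTable : List (List ℕ) := [
  [0, 4, 2, 6, 1, 8, 3, 9, 5, 7, 12, 13, 10, 11, 14, 15, 16, 19, 20, 17, 18, 23, 24, 21, 22, 25,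
  28, 29, 26, 27, 30, 34, 35, 36, 31, 32, 33, 37, 38, 42, 40, 41, 39, 46, 44, 45, 43, 49, 50,
  47, 48, 52, 51, 54, 53, 56, 55, 57, 58, 59],
  [3, 1, 5, 0, 6, 2, 4, 7, 10, 11, 8, 9, 12, 14, 13, 15, 17, 16, 18, 21, 22, 19, 20, 23, 25, 24,
  26, 27, 31, 32, 33, 28, 29, 30, 37, 38, 39, 34, 35, 36, 40, 43, 42, 41, 44, 47, 48, 45, 46,
  51, 50, 49, 52, 53, 55, 54, 57, 56, 58, 59],
  [0, 5, 2, 7, 8, 1, 9, 3, 4, 6, 11, 10, 13, 12, 14, 16, 15, 17, 18, 19, 20, 26, 27, 28, 29, 30,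
  21, 22, 23, 24, 25, 31, 33, 32, 34, 36, 35, 40, 41, 43, 37, 38, 46, 39, 45, 44, 42, 47, 48,
  49, 50, 53, 54, 51, 52, 55, 56, 58, 57, 59],
  [0, 1, 16, 3, 4, 17, 6, 18, 19, 20, 21, 22, 23, 24, 25, 15, 2, 5, 7, 8, 9, 10, 11, 12, 13, 14,
  27, 26, 29, 28, 30, 32, 31, 33, 35, 34, 36, 38, 37, 39, 44, 45, 42, 47, 40, 41, 49, 43, 51,
  46, 52, 48, 50, 53, 54, 55, 56, 57, 59, 58]]

def coord (n i : ℕ) : ℕ × ℕ := (rootTable.getD n []).getD i (0, 0)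

def perm (i n : ℕ) : ℕ := (permTable.getD i []).getD n 0

/-- The position of the `i`-th simple root in `rootTable`. -/
def simpleIdx (i : ℕ) : ℕ := if i = 3 then 15 else i

def numRoots (k : ℕ) : ℕ := if k = 3 then 15 else 60

/-- The product of `c` with minus the entry `i`, `j` of the Gram matrix, for `i ≠ j`. -/
def bondMul (i j : ℕ) (c : ℕ × ℕ) : ℕ × ℕ :=
  if i = j then (0, 0)
  else if i + j = 1 then (c.2, c.1 + c.2)
  else if i + 1 = j ∨ j + 1 = i then c
  else (0, 0)

/-- The reflection sᵢ changes only coordinate i, and new plus old value equals minus the sum of the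
other coordinates times their Gram entries. In this additive form the test stays within pairs of
natural numbers. The simple root itself is exempt: its position is fixed and only its sign changes.
-/
def tableCheck (k : ℕ) : Bool :=
  (List.range k).all fun i =>
    ((List.range k).all fun j => coord (simpleIdx i) j == if i = j then (1, 0) else (0, 0)) &&
    simpleIdx i < numRoots k && perm i (simpleIdx i) == simpleIdx i &&
    (List.range (numRoots k)).all fun n =>
      perm i n < numRoots k && (n == simpleIdx i ||
        ((List.range k).all fun j => i == j || coord (perm i n) j == coord n j) &&
        ((coord (perm i n) i).1 + (coord n i).1 ==
            ((List.range k).map fun j => (bondMul i j (coord n j)).1).sum) &&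
        ((coord (perm i n) i).2 + (coord n i).2 ==
            ((List.range k).map fun j => (bondMul i j (coord n j)).2).sum))

theorem tableCheck_three : tableCheck 3 = true := by decide +kernel

theorem tableCheck_four : tableCheck 4 = true := by decide +kernel

end table

/-! ### From the table to the real root system -/

section table

variable {k : ℕ}

/-- The real number `a + b φ`. -/
noncomputable def toReal (c : ℕ × ℕ) : ℝ := c.1 + c.2 * Real.goldenRatio

theorem toReal_nonneg (c : ℕ × ℕ) : 0 ≤ toReal c := by
  have := Real.goldenRatio_pos
  unfold toReal; positivity

/-- Irrationality of φ; this lets distinct table rows be told apart as real vectors. -/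
theorem toReal_injective : Function.Injective toReal := by
  rintro ⟨a, b⟩ ⟨c, d⟩ h
  simp only [toReal] at h
  by_cases hbd : b = d
  · subst hbd
    simpa using h
  · exfalso
    have hir := Real.goldenRatio_irrational
    apply hir
    have hne : (b : ℝ) - d ≠ 0 := by
      rw [sub_ne_zero]; exact_mod_cast hbd
    refine ⟨((c : ℚ) - a) / ((b : ℚ) - d), ?_⟩
    push_cast
    rw [div_eq_iff hne]
    linarith

theorem toReal_bondMul (i j : Fin k) (c : ℕ × ℕ) (h : i ≠ j) :
    toReal (bondMul i j c) = -(toReal c * gram k j i) := by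
  have hM : hMatrix k j i = if i.val + j.val = 1 then 5
      else if i.val + 1 = j.val ∨ j.val + 1 = i.val then 3 else 2 := by
    change (if j = i then 1 else if j.val + i.val = 1 then 5
      else if j.val + 1 = i.val ∨ i.val + 1 = j.val then 3 else 2) = _
    simp only [if_neg h.symm, add_comm j.val i.val, or_comm (a := j.val + 1 = i.val)]
  have h' : i.val ≠ j.val := fun e => h (Fin.ext e)
  rw [bondMul, if_neg h']
  simp only [gram, hM]
  split_ifs <;> simp_all [toReal]
  have hφ := Real.goldenRatio_sq
  generalize Real.goldenRatio = φ at *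
  linear_combination (-(c.2 : ℝ)) * hφ

/-- The `n`-th positive root. -/
noncomputable def posRoot (k n : ℕ) : V k := fun i => toReal (coord n i)

structure ValidTable (k : ℕ) : Prop where
  simple (i : Fin k) : posRoot k (simpleIdx i) = simpleRoot i
  simple_lt (i : Fin k) : simpleIdx i < numRoots k
  perm_simple (i : Fin k) : perm i (simpleIdx i) = simpleIdx i
  perm_lt (i : Fin k) (n : ℕ) : n < numRoots k → perm i n < numRoots k
  perm_spec (i : Fin k) (n : ℕ) : n < numRoots k → n ≠ simpleIdx i →
    geom k (s i) (posRoot k n) = posRoot k (perm i n)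

theorem validTable_of_check (h : tableCheck k = true) : ValidTable k := by
  simp only [tableCheck, List.all_eq_true, List.mem_range, Bool.and_eq_true, beq_iff_eq,
    decide_eq_true_eq, Bool.or_eq_true] at h
  refine ⟨fun i => ?_, fun i => (h i i.2).1.1.2, fun i => (h i i.2).1.2,
    fun i n hn => ((h i i.2).2 n hn).1, fun i n hn hni => ?_⟩
  · ext j
    have := (h i i.2).1.1.1 j j.2
    simp only [posRoot, this, simpleRoot, Pi.single_apply]
    by_cases hij : i = j
    · subst hij; simp [toReal]
    · have h' : i.val ≠ j.val := fun e => hij (Fin.ext e)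
      simp [toReal, h', Ne.symm hij]
  · obtain ⟨⟨h1, h2⟩, h3⟩ := (((h i i.2).2 n hn).2).resolve_left hni
    rw [geom_s, reflection_apply]
    have hip : ip k (posRoot k n) (simpleRoot i) = ∑ j : Fin k, toReal (coord n j) * gram k j i := by
      simp [ip, simpleRoot, Matrix.toBilin'_apply, Pi.single_apply, posRoot]
    have hsum : toReal (coord (perm i n) i) + toReal (coord n i) =
        ∑ j : Fin k, toReal (bondMul i j (coord n j)) := by
      have e2 : (coord (perm i n) i).1 + (coord n i).1 =
          ∑ j : Fin k, (bondMul i j (coord n j)).1 := by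
        rw [h2, Fin.sum_univ_eq_sum_range (fun j => (bondMul i j (coord n j)).1)]
        rfl
      have e3 : (coord (perm i n) i).2 + (coord n i).2 =
          ∑ j : Fin k, (bondMul i j (coord n j)).2 := by
        rw [h3, Fin.sum_univ_eq_sum_range (fun j => (bondMul i j (coord n j)).2)]
        rfl
      simp only [toReal, Finset.sum_add_distrib, ← Finset.sum_mul, ← Nat.cast_sum, ← e2, ← e3]
      push_cast; ring
    have hsum' : ∑ j : Fin k, toReal (bondMul i j (coord n j)) =
        2 * toReal (coord n i) - ip k (posRoot k n) (simpleRoot i) := by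
      rw [hip, ← Finset.add_sum_erase _ _ (Finset.mem_univ i),
        ← Finset.add_sum_erase _ (fun j : Fin k => toReal (coord n j) * gram k j i) (Finset.mem_univ i),
        gram_self, Finset.sum_congr rfl fun j hj =>
          toReal_bondMul i j (coord n j) (Finset.ne_of_mem_erase hj).symm, Finset.sum_neg_distrib]
      simp only [bondMul, if_true, toReal, Nat.cast_zero]
      ring
    ext j
    by_cases hij : j = i
    · subst hij
      simp only [posRoot, simpleRoot, Pi.sub_apply, Pi.smul_apply, Pi.single_eq_same, smul_eq_mul]
      have : ip k (posRoot k n) (Pi.single j 1) = ip k (posRoot k n) (simpleRoot j) := rfl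
      change toReal _ - ip k (posRoot k n) (Pi.single j 1) * 1 = _
      rw [this]
      linarith
    · have h' : i.val ≠ j.val := fun e => hij (Fin.ext e.symm)
      have := (h1 j j.2).resolve_left h'
      simp [simpleRoot, posRoot, hij, this]

theorem validTable_three : ValidTable 3 := validTable_of_check tableCheck_three

theorem validTable_four : ValidTable 4 := validTable_of_check tableCheck_four

/-- A root, given by the position of a positive root and a sign. -/
noncomputable def root (k : ℕ) (x : ℕ × Bool) : V k :=
  bif x.2 then -posRoot k x.1 else posRoot k x.1

/-- The action of a simple reflection on positions of roots. -/
def simpleAct (i : ℕ) (x : ℕ × Bool) : ℕ × Bool := (perm i x.1, xor x.2 (x.1 == simpleIdx i))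

/-- The action of a word in the simple reflections on positions of roots. -/
def wordAct (l : List (Fin k)) (x : ℕ × Bool) : ℕ × Bool := l.foldr (fun i => simpleAct i) x

def wordProd (l : List (Fin k)) : W k := (l.map s).prod

theorem wordProd_surjective (w : W k) : ∃ l, wordProd l = w := by
  obtain ⟨l, rfl⟩ := (hMatrix k).toCoxeterSystem.wordProd_surjective w
  exact ⟨l, rfl⟩

namespace ValidTable

variable (H : ValidTable k)
include H

theorem geom_s_root (i : Fin k) {x : ℕ × Bool} (hx : x.1 < numRoots k) :
    geom k (s i) (root k x) = root k (simpleAct i x) := by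
  obtain ⟨n, b⟩ := x
  have hneg : geom k (s i) (simpleRoot i) = -simpleRoot i := by
    have := geom_mul_s_self 1 i
    rwa [one_mul, map_one] at this
  by_cases hn : n = simpleIdx i
  · subst hn
    cases b <;> simp [root, simpleAct, H.simple, H.perm_simple, hneg]
  · have := H.perm_spec i n hx hn
    have hn' : (n == simpleIdx i) = false := by simpa using hn
    cases b <;> simp [root, simpleAct, this, hn']

theorem wordAct_lt (l : List (Fin k)) {x : ℕ × Bool} (hx : x.1 < numRoots k) :
    (wordAct l x).1 < numRoots k := by
  induction l with
  | nil => exact hx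
  | cons i l ih => exact H.perm_lt i _ ih

theorem geom_wordProd_root (l : List (Fin k)) {x : ℕ × Bool} (hx : x.1 < numRoots k) :
    geom k (wordProd l) (root k x) = root k (wordAct l x) := by
  induction l with
  | nil => simp [wordProd, wordAct]
  | cons i l ih =>
    have : wordProd (i :: l) = s i * wordProd l := by simp [wordProd]
    rw [this, geom_mul_apply, ih, H.geom_s_root i (H.wordAct_lt l hx)]
    rfl

theorem root_simple (i : Fin k) : root k (simpleIdx i, false) = simpleRoot i := H.simple i

theorem exists_geom_root (w : W k) {x : ℕ × Bool} (hx : x.1 < numRoots k) :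
    ∃ y : ℕ × Bool, y.1 < numRoots k ∧ geom k w (root k x) = root k y := by
  obtain ⟨l, rfl⟩ := wordProd_surjective w
  exact ⟨_, H.wordAct_lt l hx, H.geom_wordProd_root l hx⟩

/-- The group permutes the signed rows of the table, and all coordinates in the table are
non-negative. Only the chamber vector has to be supplied. -/
theorem finiteRoots (hc : ∃ c : V k, ∀ i, 0 < ip k c (simpleRoot i)) : FiniteRoots k where
  nonneg_or_nonpos w i := by
    obtain ⟨⟨n, b⟩, -, hy⟩ := H.exists_geom_root w (x := (simpleIdx i, false)) (H.simple_lt i)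
    rw [H.root_simple] at hy
    rw [hy]
    have : 0 ≤ posRoot k n := fun i => toReal_nonneg _
    cases b
    · exact Or.inl this
    · exact Or.inr (by simpa [root] using this)
  finite := by
    refine (((Set.finite_Iio (numRoots k)).prod (Set.finite_univ (α := Bool))).image
      (root k)).subset ?_
    rintro _ ⟨⟨w, i⟩, rfl⟩
    obtain ⟨y, hy, h⟩ := H.exists_geom_root w (x := (simpleIdx i, false)) (H.simple_lt i)
    exact ⟨y, ⟨hy, Set.mem_univ _⟩, by rw [← h, H.root_simple]⟩
  dominant := hc

end ValidTable

theorem gram_three : gram 3 = !![2, -Real.goldenRatio, 0; -Real.goldenRatio, 2, -1; 0, -1, 2] := by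
  ext i j
  fin_cases i <;> fin_cases j <;> simp [gram, hMatrix]

theorem gram_four : gram 4 = !![2, -Real.goldenRatio, 0, 0; -Real.goldenRatio, 2, -1, 0;
    0, -1, 2, -1; 0, 0, -1, 2] := by
  ext i j
  fin_cases i <;> fin_cases j <;> simp [gram, hMatrix]

theorem ip_eq (u v : V k) : ip k u v = ∑ i, ∑ j, u i * gram k i j * v j := by
  simp [ip, Matrix.toBilin'_apply]

theorem goldenRatio_bounds : (1.618 : ℝ) < Real.goldenRatio ∧ Real.goldenRatio < 1.6181 := by
  have h := Real.goldenRatio_sq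
  have h0 := Real.goldenRatio_pos
  constructor <;> nlinarith

theorem finiteRoots_three : FiniteRoots 3 := by
  -- An integral point of the open chamber: its products with the simple roots are 12 - 7φ, 10 - 6φ
  -- and 1.
  refine validTable_three.finiteRoots ⟨![6, 7, 4], fun i => ?_⟩
  have := goldenRatio_bounds
  rw [ip_eq, gram_three]
  fin_cases i <;> simp [Fin.sum_univ_three, simpleRoot] <;> linarith [this.1, this.2]

theorem finiteRoots_four : FiniteRoots 4 := by
  -- The products with the simple roots are 112 - 69φ, 91 - 56φ, 1 and 1.
  refine validTable_four.finiteRoots ⟨![56, 69, 47, 24], fun i => ?_⟩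
  have := goldenRatio_bounds
  rw [ip_eq, gram_four]
  fin_cases i <;> simp [Fin.sum_univ_four, simpleRoot] <;> linarith [this.1, this.2]

end table

/-! ### Consequences of the defining relations -/

section relations

variable {k : ℕ} [NeZero k]

theorem mkAlgHom_eq {x y : FreeAlgebra Scalars (Gen k)} (h : Rel k x y) :
    RingQuot.mkAlgHom Scalars (Rel k) x = RingQuot.mkAlgHom Scalars (Rel k) y :=
  RingQuot.mkAlgHom_rel Scalars h

theorem e_def (i : Fin k) : (e i : Br k) = RingQuot.mkAlgHom Scalars (Rel k) (freeE i) := rfl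

theorem toBr_s (i : Fin k) : toBr k (s i) = r i :=
  (hMatrix k).toCoxeterSystem.lift_apply_simple (r_isLiftable k) i

theorem r_mul_r (i : Fin k) : (r i * r i : Br k) = 1 := by
  simpa only [map_mul, map_one, ← r_def] using mkAlgHom_eq (Rel.r_sq i)

theorem r_mul_r_mul (i : Fin k) (a : Br k) : r i * (r i * a) = a := by
  rw [← mul_assoc, r_mul_r, one_mul]

theorem r_mul_e (i : Fin k) : (r i * e i : Br k) = e i := by
  simpa only [map_mul, ← r_def, ← e_def] using mkAlgHom_eq (Rel.r_e i)

theorem e_mul_r (i : Fin k) : (e i * r i : Br k) = e i := by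
  simpa only [map_mul, ← r_def, ← e_def] using mkAlgHom_eq (Rel.e_r i)

theorem e_mul_e (i : Fin k) : (e i * e i : Br k) = deltaPow 2 • e i := by
  simpa only [map_mul, map_smul, ← r_def, ← e_def] using mkAlgHom_eq (Rel.e_sq i)

theorem e_r_comm {i j : Fin k} (h : hMatrix k i j = 2) : (e i * r j : Br k) = r j * e i := by
  simpa only [map_mul, ← r_def, ← e_def] using mkAlgHom_eq (Rel.comm_er i j h)

theorem e_e_comm {i j : Fin k} (h : hMatrix k i j = 2) : (e i * e j : Br k) = e j * e i := by
  simpa only [map_mul, ← r_def, ← e_def] using mkAlgHom_eq (Rel.comm_ee i j h)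

theorem r_r_e {i j : Fin k} (h : hMatrix k i j = 3) : (r j * r i * e j : Br k) = e i * e j := by
  simpa only [map_mul, ← r_def, ← e_def] using mkAlgHom_eq (Rel.rre i j h)

theorem r_e_r {i j : Fin k} (h : hMatrix k i j = 3) :
    (r i * e j * r i : Br k) = r j * e i * r j := by
  simpa only [map_mul, ← r_def, ← e_def] using mkAlgHom_eq (Rel.rer i j h)

theorem r_r_e_r_r : (r 0 * r 1 * e 0 * r 1 * r 0 : Br k) = r 1 * r 0 * e 1 * r 0 * r 1 := by
  simpa only [map_mul, ← r_def, ← e_def] using mkAlgHom_eq (k := k) Rel.rrerr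

theorem e_r_e : (e 0 * r 1 * e 0 : Br k) = e 0 := by
  simpa only [map_mul, ← r_def, ← e_def] using mkAlgHom_eq (k := k) Rel.ere

theorem e_r_r_r_e : (e 0 * r 1 * r 0 * r 1 * e 0 : Br k) = e 0 := by
  simpa only [map_mul, ← r_def, ← e_def] using mkAlgHom_eq (k := k) Rel.errre

omit [NeZero k] in
theorem hMatrix_symm {i j : Fin k} {m : ℕ} (h : hMatrix k i j = m) : hMatrix k j i = m := by
  rw [← h]; exact (hMatrix k).symmetric j i

/-- The mirror image of rⱼrᵢeⱼ = eᵢeⱼ. It is not among the defining relations, but follows by moving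
reflections across with rᵢeⱼrᵢ = rⱼeᵢrⱼ. -/
theorem e_r_r {i j : Fin k} (h : hMatrix k i j = 3) : (e j * r i * r j : Br k) = e j * e i := by
  have h1 := r_e_r h
  have h2 := r_r_e (hMatrix_symm h)
  calc (e j * r i * r j : Br k) = r i * (r i * e j * r i) * r j := by
        simp only [mul_assoc, r_mul_r_mul]
    _ = r i * r j * e i := by rw [h1]; simp only [mul_assoc, r_mul_r, mul_one]
    _ = e j * e i := h2

/-- The simple-bond analogue of the defining relation e₁r₂e₁ = e₁: after eⱼ = rⱼeⱼ is inserted,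
eⱼrᵢrⱼ = rᵢrⱼeᵢ meets eᵢeⱼ = rⱼrᵢeⱼ and the reflections cancel. -/
theorem e_r_e_simple {i j : Fin k} (h : hMatrix k i j = 3) : (e j * r i * e j : Br k) = e j := by
  calc (e j * r i * e j : Br k) = e j * r i * (r j * e j) := by rw [r_mul_e]
    _ = e j * r i * r j * e j := by simp only [mul_assoc]
    _ = r i * r j * e i * e j := by rw [e_r_r h, r_r_e (hMatrix_symm h)]
    _ = r i * r j * (r j * r i * e j) := by rw [r_r_e h, mul_assoc]
    _ = e j := by simp only [mul_assoc, r_mul_r_mul]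

theorem toBr_mul_inv (w : W k) : toBr k w * toBr k w⁻¹ = 1 := by rw [← map_mul]; simp

theorem toBr_inv_mul (w : W k) : toBr k w⁻¹ * toBr k w = 1 := by rw [← map_mul]; simp

theorem deltaPow_smul_smul (m n : ℤ) (a : Br k) :
    deltaPow m • deltaPow n • a = deltaPow (m + n) • a := by
  rw [smul_smul, deltaPow, deltaPow, deltaPow, LaurentPolynomial.T_add]

theorem deltaPow_zero_smul (a : Br k) : deltaPow 0 • a = a := by
  rw [deltaPow, LaurentPolynomial.T_zero, one_smul]

/-- The elements that commute with `e₁`. -/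
noncomputable def centralizerE (k : ℕ) [NeZero k] : Subgroup (W k) where
  carrier := {w | toBr k w * e 0 = e 0 * toBr k w}
  one_mem' := by simp
  mul_mem' {a b} ha hb := by
    simp only [Set.mem_ofPred_eq, map_mul] at ha hb ⊢
    rw [mul_assoc, hb, ← mul_assoc, ha, mul_assoc]
  inv_mem' {a} ha := by
    simp only [Set.mem_ofPred_eq] at ha ⊢
    calc toBr k a⁻¹ * e 0 = toBr k a⁻¹ * (e 0 * toBr k a) * toBr k a⁻¹ := by
          simp only [mul_assoc, toBr_mul_inv, mul_one]
      _ = e 0 * toBr k a⁻¹ := by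
          rw [← ha]; simp only [← mul_assoc, toBr_inv_mul, one_mul]

/-- The elements that fix `e₁ e₃` from both sides. -/
noncomputable def fixerEE (k : ℕ) [NeZero k] : Subgroup (W k) where
  carrier := {w | toBr k w * (e 0 * e 2) = e 0 * e 2 ∧ e 0 * e 2 * toBr k w = e 0 * e 2}
  one_mem' := by simp
  mul_mem' {a b} ha hb := by
    simp only [Set.mem_ofPred_eq, map_mul] at ha hb ⊢
    exact ⟨by rw [mul_assoc, hb.1, ha.1], by rw [← mul_assoc, ha.2, hb.2]⟩
  inv_mem' {a} ha := by
    simp only [Set.mem_ofPred_eq] at ha ⊢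
    constructor
    · conv_lhs => rw [← ha.1, ← mul_assoc, toBr_inv_mul, one_mul]
    · conv_lhs => rw [← ha.2, mul_assoc, toBr_mul_inv, mul_one]

/-- The element `r₂r₁r₂r₁` (in the usual numbering), which maps `β₂` to `±β₁`. -/
def rot12 (k : ℕ) [NeZero k] : W k := s 1 * s 0 * s 1 * s 0

/-- The element `r₂r₁r₂r₁r₃r₂` (in the usual numbering), which maps `β₁` to `β₅` and `β₃`
to `±β₁`. -/
def rot135 (k : ℕ) [NeZero k] : W k := s 1 * s 0 * s 1 * s 0 * s 2 * s 1

theorem r5_eq : r5 k = rot135 k * s 0 * (rot135 k)⁻¹ := rfl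

theorem rot12_mul_e : toBr k (rot12 k) * e 1 = e 0 * toBr k (rot12 k) := by
  have h := r_r_e_r_r (k := k)
  simp only [rot12, map_mul, toBr_s]
  calc (r 1 * r 0 * r 1 * r 0 * e 1 : Br k)
      = r 1 * r 0 * (r 1 * r 0 * e 1 * r 0 * r 1) * (r 1 * r 0) := by
        simp only [mul_assoc, r_mul_r_mul, r_mul_r, mul_one]
    _ = e 0 * (r 1 * r 0 * r 1 * r 0) := by
        rw [← h]; simp only [mul_assoc, r_mul_r_mul]

/-- The bonds among the first three nodes. -/
structure StartsWithH3 (k : ℕ) [NeZero k] : Prop where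
  bond : hMatrix k 1 2 = 3
  noBond : hMatrix k 0 2 = 2

variable (H : StartsWithH3 k)
include H

/-- The conjugation passes through e₂: r₃r₂ carries e₃ to e₂, and `rot12` carries e₂ to e₁. -/
theorem rot135_mul_e : toBr k (rot135 k) * e 2 = e 0 * toBr k (rot135 k) := by
  have h1 := rot12_mul_e (k := k)
  have h2 := r_e_r H.bond
  have h3 : (r 2 * r 1 * e 2 : Br k) = e 1 * (r 2 * r 1) := by
    calc (r 2 * r 1 * e 2 : Br k) = r 2 * (r 1 * e 2 * r 1) * r 1 := by
          simp only [mul_assoc, r_mul_r, mul_one]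
      _ = _ := by rw [h2]; simp only [mul_assoc, r_mul_r_mul]
  have hx : toBr k (rot135 k) = toBr k (rot12 k) * (r 2 * r 1) := by
    simp only [rot135, rot12, map_mul, toBr_s, mul_assoc]
  rw [hx, mul_assoc, h3, ← mul_assoc, h1, mul_assoc]

theorem e_mul_rot135_inv :
    e 2 * toBr k (rot135 k)⁻¹ = toBr k (rot135 k)⁻¹ * e 0 := by
  calc e 2 * toBr k (rot135 k)⁻¹
      = toBr k (rot135 k)⁻¹ * (toBr k (rot135 k) * e 2) * toBr k (rot135 k)⁻¹ := by
        simp only [← mul_assoc, toBr_inv_mul, one_mul]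
    _ = _ := by rw [rot135_mul_e H]; simp only [mul_assoc, toBr_mul_inv, mul_one]

/-- Conjugation by `rot135` carries r₁ to r₅ and e₃ to e₁, and r₁ commutes with e₃. -/
theorem r5_mem_centralizerE : r5 k ∈ centralizerE k := by
  change toBr k (r5 k) * e 0 = e 0 * toBr k (r5 k)
  rw [r5_eq, map_mul, map_mul, toBr_s, mul_assoc, ← e_mul_rot135_inv H, ← mul_assoc,
    mul_assoc _ (r 0), ← e_r_comm (hMatrix_symm H.noBond), ← mul_assoc, rot135_mul_e H]
  simp only [mul_assoc]

omit H in
theorem s_zero_mem_centralizerE : s 0 ∈ centralizerE k := by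
  change toBr k (s 0) * e 0 = e 0 * toBr k (s 0)
  rw [toBr_s, r_mul_e, e_mul_r]

omit H in
theorem s_mem_centralizerE {j : Fin k} (h : hMatrix k 0 j = 2) : s j ∈ centralizerE k := by
  change toBr k (s j) * e 0 = e 0 * toBr k (s j)
  rw [toBr_s, e_r_comm h]

omit H in
theorem rot12_inv_mul_e (a : Br k) :
    a * e 0 * toBr k (rot12 k)⁻¹ * e 0 = a * e 0 := by
  have := e_r_r_r_e (k := k)
  calc a * e 0 * toBr k (rot12 k)⁻¹ * e 0 = a * ((e 0 * r 0) * r 1 * r 0 * r 1 * e 0) := by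
        simp only [rot12, mul_inv_rev, s_inv, map_mul, toBr_s, mul_assoc]
    _ = _ := by rw [e_mul_r, this]

/-- The factor r₃r₂e₃ becomes e₂e₃, then `rot12` turns e₂ into e₁ on its left, and e₁r₂r₁r₂e₁ = e₁
removes what is left. On the right the same computation is made for the inverse. -/
theorem rot135_mem_fixerEE : rot135 k ∈ fixerEE k := by
  have h02 := e_e_comm H.noBond
  have h1 : toBr k (rot135 k) * (e 0 * e 2) = e 0 * e 2 := by
    calc toBr k (rot135 k) * (e 0 * e 2)
        = toBr k (rot12 k) * ((r 2 * r 1 * e 2) * e 0) := by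
          rw [h02]; simp only [rot135, rot12, map_mul, toBr_s, mul_assoc]
      _ = (toBr k (rot12 k) * e 1) * (e 0 * e 2) := by rw [r_r_e H.bond, h02]; simp only [mul_assoc]
      _ = (e 0 * r 1 * r 0 * r 1) * (r 0 * e 0) * e 2 := by
          rw [rot12_mul_e]; simp only [rot12, map_mul, toBr_s, mul_assoc]
      _ = e 0 * e 2 := by rw [r_mul_e, e_r_r_r_e]
  have h2 : e 0 * e 2 * toBr k (rot135 k)⁻¹ = e 0 * e 2 := by
    have hinv : e 1 * toBr k (rot12 k)⁻¹ = toBr k (rot12 k)⁻¹ * e 0 := by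
      calc e 1 * toBr k (rot12 k)⁻¹
          = toBr k (rot12 k)⁻¹ * (toBr k (rot12 k) * e 1) * toBr k (rot12 k)⁻¹ := by
            simp only [← mul_assoc, toBr_inv_mul, one_mul]
        _ = _ := by rw [rot12_mul_e]; simp only [mul_assoc, toBr_mul_inv, mul_one]
    calc e 0 * e 2 * toBr k (rot135 k)⁻¹
        = e 0 * (e 2 * r 1 * r 2) * toBr k (rot12 k)⁻¹ := by
          simp only [rot135, rot12, mul_inv_rev, s_inv, map_mul, toBr_s, mul_assoc]
      _ = e 2 * e 0 * (e 1 * toBr k (rot12 k)⁻¹) := by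
          rw [e_r_r H.bond, ← h02]; simp only [mul_assoc]
      _ = e 2 * e 0 * toBr k (rot12 k)⁻¹ * e 0 := by rw [hinv]; simp only [mul_assoc]
      _ = e 0 * e 2 := by rw [rot12_inv_mul_e, h02]
  refine ⟨h1, ?_⟩
  conv_lhs => rw [← h2, mul_assoc, toBr_inv_mul, mul_one]

omit H in
theorem s_zero_mem_fixerEE (H : StartsWithH3 k) : s 0 ∈ fixerEE k := by
  refine ⟨?_, ?_⟩
  · rw [toBr_s, ← mul_assoc, r_mul_e]
  · rw [toBr_s, e_e_comm H.noBond, mul_assoc, e_mul_r]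

theorem s_two_mem_fixerEE : s 2 ∈ fixerEE k := by
  refine ⟨?_, ?_⟩
  · rw [toBr_s, e_e_comm H.noBond, ← mul_assoc, r_mul_e]
  · rw [toBr_s, mul_assoc, e_mul_r]

theorem r5_mem_fixerEE : r5 k ∈ fixerEE k := by
  have h := rot135_mem_fixerEE H
  exact mul_mem (mul_mem h (s_zero_mem_fixerEE H)) (inv_mem h)

/-- This is where e₁e₃ arises from e₁ w e₁: the left e₁ crosses `rot135` and becomes e₃, and the
product e₁e₃ absorbs `rot135`. -/
theorem e_rot135_e : e 0 * toBr k (rot135 k) * e 0 = e 0 * e 2 := by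
  rw [← rot135_mul_e H, mul_assoc, ← e_e_comm H.noBond]
  exact (rot135_mem_fixerEE H).1

theorem e_rot135_inv_e : e 0 * toBr k (rot135 k)⁻¹ * e 0 = e 0 * e 2 := by
  rw [mul_assoc, ← e_mul_rot135_inv H, ← mul_assoc]
  exact (inv_mem (rot135_mem_fixerEE H)).2

/-- The relation e₃r₂e₃ = e₃, conjugated by `rot135`. -/
theorem e_rot135_s_rot135_inv_e :
    e 0 * toBr k (rot135 k * s 1 * (rot135 k)⁻¹) * e 0 = e 0 := by
  calc e 0 * toBr k (rot135 k * s 1 * (rot135 k)⁻¹) * e 0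
      = (e 0 * toBr k (rot135 k)) * r 1 * (toBr k (rot135 k)⁻¹ * e 0) := by
        simp only [map_mul, toBr_s, mul_assoc]
    _ = toBr k (rot135 k) * (e 2 * r 1 * e 2) * toBr k (rot135 k)⁻¹ := by
        rw [← rot135_mul_e H, ← e_mul_rot135_inv H]; simp only [mul_assoc]
    _ = e 0 := by
        rw [e_r_e_simple H.bond, rot135_mul_e H, mul_assoc, toBr_mul_inv, mul_one]

end relations

/-! ### Reduction to three types and choice of representatives -/

section reduction

variable {k : ℕ} [NeZero k]

/-- `a` is a power of `δ` times an element of one of the three types, with unrestricted group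
elements. -/
def IsReduced (a : Br k) : Prop :=
  ∃ m : ℤ, (∃ w, a = deltaPow m • toBr k w) ∨
    (∃ u w, a = deltaPow m • (toBr k u * e 0 * toBr k w)) ∨
    ∃ u w, a = deltaPow m • (toBr k u * (e 0 * e 2) * toBr k w)

theorem IsReduced.smul {a : Br k} (h : IsReduced a) (n : ℤ) : IsReduced (deltaPow n • a) := by
  obtain ⟨m, ⟨w, rfl⟩ | ⟨u, w, rfl⟩ | ⟨u, w, rfl⟩⟩ := h
  · exact ⟨n + m, Or.inl ⟨w, deltaPow_smul_smul _ _ _⟩⟩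
  · exact ⟨n + m, Or.inr (Or.inl ⟨u, w, deltaPow_smul_smul _ _ _⟩)⟩
  · exact ⟨n + m, Or.inr (Or.inr ⟨u, w, deltaPow_smul_smul _ _ _⟩)⟩

theorem IsReduced.toBr_mul {a : Br k} (h : IsReduced a) (g : W k) : IsReduced (toBr k g * a) := by
  obtain ⟨m, ⟨w, rfl⟩ | ⟨u, w, rfl⟩ | ⟨u, w, rfl⟩⟩ := h
  · exact ⟨m, Or.inl ⟨g * w, by rw [mul_smul_comm, map_mul]⟩⟩
  · exact ⟨m, Or.inr (Or.inl ⟨g * u, w, by simp only [mul_smul_comm, map_mul, mul_assoc]⟩)⟩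
  · exact ⟨m, Or.inr (Or.inr ⟨g * u, w, by simp only [mul_smul_comm, map_mul, mul_assoc]⟩)⟩

theorem IsReduced.mul_toBr {a : Br k} (h : IsReduced a) (g : W k) : IsReduced (a * toBr k g) := by
  obtain ⟨m, ⟨w, rfl⟩ | ⟨u, w, rfl⟩ | ⟨u, w, rfl⟩⟩ := h
  · exact ⟨m, Or.inl ⟨w * g, by rw [smul_mul_assoc, map_mul]⟩⟩
  · exact ⟨m, Or.inr (Or.inl ⟨u, w * g, by simp only [smul_mul_assoc, map_mul, mul_assoc]⟩)⟩
  · exact ⟨m, Or.inr (Or.inr ⟨u, w * g, by simp only [smul_mul_assoc, map_mul, mul_assoc]⟩)⟩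

/-- `e₁ w e₁` lies in `δ^ℤ W e₁`. -/
def CollapsesLeft (w : W k) : Prop :=
  ∃ (m : ℤ) (v : W k), e 0 * toBr k w * e 0 = deltaPow m • (toBr k v * e 0)

/-- `e₁ w e₁` lies in `W e₁ e₃ W`. -/
def CollapsesTwo (w : W k) : Prop :=
  ∃ u v : W k, e 0 * toBr k w * e 0 = toBr k u * (e 0 * e 2) * toBr k v

theorem e_toBr_mul_e {n : W k} (hn : n ∈ centralizerE k) (w : W k) :
    e 0 * toBr k (n * w) * e 0 = toBr k n * (e 0 * toBr k w * e 0) := by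
  have : toBr k n * e 0 = e 0 * toBr k n := hn
  rw [map_mul, ← mul_assoc, ← this]; simp only [mul_assoc]

theorem e_toBr_mul_e' {n : W k} (hn : n ∈ centralizerE k) (w : W k) :
    e 0 * toBr k (w * n) * e 0 = e 0 * toBr k w * e 0 * toBr k n := by
  have : toBr k n * e 0 = e 0 * toBr k n := hn
  rw [map_mul, mul_assoc, mul_assoc, this]; simp only [mul_assoc]

theorem CollapsesLeft.mul_left {w n : W k} (h : CollapsesLeft w) (hn : n ∈ centralizerE k) :
    CollapsesLeft (n * w) := by
  obtain ⟨m, v, h⟩ := h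
  exact ⟨m, n * v, by rw [e_toBr_mul_e hn, h, mul_smul_comm, map_mul, mul_assoc]⟩

theorem CollapsesLeft.mul_right {w n : W k} (h : CollapsesLeft w) (hn : n ∈ centralizerE k) :
    CollapsesLeft (w * n) := by
  obtain ⟨m, v, h⟩ := h
  have hn' : toBr k n * e 0 = e 0 * toBr k n := hn
  exact ⟨m, v * n, by rw [e_toBr_mul_e' hn, h, smul_mul_assoc, map_mul, mul_assoc, ← hn',
    mul_assoc]⟩

theorem CollapsesTwo.mul_left {w n : W k} (h : CollapsesTwo w) (hn : n ∈ centralizerE k) :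
    CollapsesTwo (n * w) := by
  obtain ⟨u, v, h⟩ := h
  exact ⟨n * u, v, by rw [e_toBr_mul_e hn, h, map_mul]; simp only [mul_assoc]⟩

theorem CollapsesTwo.mul_right {w n : W k} (h : CollapsesTwo w) (hn : n ∈ centralizerE k) :
    CollapsesTwo (w * n) := by
  obtain ⟨u, v, h⟩ := h
  exact ⟨u, v * n, by rw [e_toBr_mul_e' hn, h, map_mul]; simp only [mul_assoc]⟩

theorem collapsesLeft_of_eq {w : W k} (h : e 0 * toBr k w * e 0 = e 0) : CollapsesLeft w :=
  ⟨0, 1, by rw [h, map_one, one_mul, deltaPow_zero_smul]⟩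

theorem collapsesLeft_one : CollapsesLeft (1 : W k) :=
  ⟨2, 1, by rw [map_one, one_mul, mul_one, e_mul_e]⟩

theorem collapsesLeft_s_one : CollapsesLeft (s 1 : W k) :=
  collapsesLeft_of_eq (by rw [toBr_s, e_r_e])

theorem collapsesLeft_s_one_zero_one : CollapsesLeft (s 1 * s 0 * s 1 : W k) :=
  collapsesLeft_of_eq (by simpa only [map_mul, toBr_s, mul_assoc] using e_r_r_r_e (k := k))

theorem collapsesTwo_of_eq {w : W k} (h : e 0 * toBr k w * e 0 = e 0 * e 2) : CollapsesTwo w :=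
  ⟨1, 1, by rw [h, map_one, one_mul, mul_one]⟩

/-- Left multiplication by δ and by group elements preserves each type, and `hconj` reduces every eᵢ
to e₁. The hypotheses `hcol` and `hfix` deal with e₁ in front of the second and third types. -/
theorem isReduced_of_mem (hconj : ∀ i : Fin k, ∃ g, e i = toBr k g * e 0 * toBr k g⁻¹)
    (hcol : ∀ w : W k, CollapsesLeft w ∨ CollapsesTwo w)
    (hfix : ∀ w : W k, ∃ κ ∈ fixerEE k, CollapsesLeft (w * κ)) {a : Br k} (ha : a ∈ BrM k) :
    IsReduced a := by
  have he0 : ∀ a : Br k, IsReduced a → IsReduced (e 0 * a) := by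
    rintro _ ⟨m, ⟨w, rfl⟩ | ⟨u, w, rfl⟩ | ⟨u, w, rfl⟩⟩
    · exact ⟨m, Or.inr (Or.inl ⟨1, w, by rw [mul_smul_comm, map_one, one_mul]⟩)⟩
    · rw [mul_smul_comm, ← mul_assoc, ← mul_assoc]
      refine IsReduced.smul (IsReduced.mul_toBr ?_ w) m
      rcases hcol u with ⟨m', v, h⟩ | ⟨u', v, h⟩
      · rw [h]
        exact ⟨m', Or.inr (Or.inl ⟨v, 1, by rw [map_one, mul_one]⟩)⟩
      · rw [h]
        exact ⟨0, Or.inr (Or.inr ⟨u', v, by rw [deltaPow_zero_smul]⟩)⟩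
    -- Since e₁e₃ absorbs κ, u may be replaced by uκ, for which e₁ uκ e₁ collapses and leaves e₃
    -- untouched.
    · obtain ⟨κ, hκ, m', v, h⟩ := hfix u
      have : e 0 * (toBr k u * (e 0 * e 2)) = deltaPow m' • (toBr k v * (e 0 * e 2)) := by
        calc e 0 * (toBr k u * (e 0 * e 2))
            = e 0 * (toBr k u * (toBr k κ * (e 0 * e 2))) := by rw [hκ.1]
          _ = e 0 * toBr k (u * κ) * e 0 * e 2 := by simp only [map_mul, mul_assoc]
          _ = _ := by rw [h, smul_mul_assoc, mul_assoc]
      rw [mul_smul_comm, ← mul_assoc, this, smul_mul_assoc]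
      exact IsReduced.smul ⟨m', Or.inr (Or.inr ⟨v, w, rfl⟩)⟩ m |> fun h => by
        simpa only [smul_mul_assoc] using h
  have hgen : ∀ x ∈ ({algebraMap Scalars (Br k) (deltaPow 1)} ∪ Set.range r ∪ Set.range e :
      Set (Br k)), ∀ a, IsReduced a → IsReduced (x * a) := by
    rintro x ((rfl | ⟨i, rfl⟩) | ⟨i, rfl⟩) a h
    · rw [← Algebra.smul_def]; exact h.smul 1
    · rw [← toBr_s]; exact h.toBr_mul _
    · obtain ⟨g, hg⟩ := hconj i
      rw [hg, mul_assoc, mul_assoc]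
      exact (he0 _ (h.toBr_mul _)).toBr_mul _
  induction ha using Submonoid.closure_induction_left with
  | one => exact ⟨0, Or.inl ⟨1, by rw [map_one, deltaPow_zero_smul]⟩⟩
  | mul_left x hx y _ ih => exact hgen x hx y ih

/-- In u e₁ w the N₁-parts of u and w⁻¹ commute with e₁ and combine into one element next to it. In
the third type the N₂-parts are absorbed by e₁e₃, so no middle factor remains. -/
theorem exists_normalForm {D₁ C₁ D₂ : Set (W k)} {N₁ C N₂ : Subgroup (W k)}
    (hred : ∀ a ∈ BrM k, IsReduced a)
    (hD₁ : IsLeftTransversal D₁ N₁ ⊤) (hD₂ : IsLeftTransversal D₂ N₂ ⊤)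
    (hN₁ : ∀ n ∈ N₁, n ∈ C ∨ n * s 0 ∈ C) (hC : C ≤ centralizerE k)
    (hC₁ : ∀ c ∈ C, ∃ d ∈ C₁, d ∈ C ∧ toBr k c * e 0 = toBr k d * e 0)
    (hN₂ : N₂ ≤ fixerEE k) :
    ∀ a ∈ BrM k, ∃ n : ℤ, ∃ f ∈ normalForms D₁ C₁ D₂, a = deltaPow n • f.eval := by
  intro a ha
  obtain ⟨m, ⟨w, rfl⟩ | ⟨u, w, rfl⟩ | ⟨u, w, rfl⟩⟩ := hred a ha
  · exact ⟨m, .typeI w, trivial, rfl⟩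
  · have cen : ∀ n ∈ N₁, n ∈ centralizerE k := by
      intro n hn
      rcases hN₁ n hn with h | h
      · exact hC h
      · have := mul_mem (hC h) (s_zero_mem_centralizerE (k := k))
        rwa [mul_assoc, s_mul_s, mul_one] at this
    obtain ⟨d, ⟨hd, hdn⟩, -⟩ := hD₁.2 u trivial
    obtain ⟨d', ⟨hd', hdn'⟩, -⟩ := hD₁.2 w⁻¹ trivial
    set n := d⁻¹ * u with hn
    set n' := d'⁻¹ * w⁻¹ with hn'
    have hu : u = d * n := by rw [hn]; group
    have hw : w = n'⁻¹ * d'⁻¹ := by rw [hn']; group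
    have hnn : n * n'⁻¹ ∈ N₁ := mul_mem hdn (inv_mem hdn')
    -- As r₁e₁ = e₁, an element of N₁ outside C may be multiplied by r₁ and brought into C.
    obtain ⟨c, hc, hce⟩ : ∃ c ∈ C, toBr k (n * n'⁻¹) * e 0 = toBr k c * e 0 := by
      rcases hN₁ _ hnn with h | h
      · exact ⟨_, h, rfl⟩
      · refine ⟨_, h, ?_⟩
        rw [map_mul _ _ (s 0), toBr_s, mul_assoc (toBr k (n * n'⁻¹)), r_mul_e]
    obtain ⟨v, hv, hvC, hve⟩ := hC₁ c hc
    refine ⟨m, .typeII d v d'⁻¹, ⟨hd, hv, by rwa [inv_inv]⟩, ?_⟩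
    have h1 : toBr k n'⁻¹ * e 0 = e 0 * toBr k n'⁻¹ := cen _ (inv_mem hdn')
    have h2 : toBr k v * e 0 = e 0 * toBr k v := hC hvC
    congr 1
    calc toBr k u * e 0 * toBr k w
        = toBr k d * (toBr k n * (e 0 * toBr k n'⁻¹)) * toBr k d'⁻¹ := by
          rw [hu, hw]; simp only [map_mul, mul_assoc]
      _ = toBr k d * (toBr k (n * n'⁻¹) * e 0) * toBr k d'⁻¹ := by
          rw [← h1]; simp only [map_mul, mul_assoc]
      _ = _ := by rw [hce, hve, h2]; simp only [Form.eval, mul_assoc]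
  · obtain ⟨d, ⟨hd, hdn⟩, -⟩ := hD₂.2 u trivial
    obtain ⟨d', ⟨hd', hdn'⟩, -⟩ := hD₂.2 w⁻¹ trivial
    refine ⟨m, .typeIII d d'⁻¹, ⟨hd, by rwa [inv_inv]⟩, ?_⟩
    have h1 := (hN₂ hdn).1
    have h2 := (hN₂ (inv_mem hdn')).2
    have hu : u = d * (d⁻¹ * u) := by group
    have hw : w = (d'⁻¹ * w⁻¹)⁻¹ * d'⁻¹ := by group
    congr 1
    conv_lhs => rw [hu, hw]
    rw [map_mul _ d, map_mul _ _ d'⁻¹, mul_assoc (toBr k d), h1, mul_assoc, ← mul_assoc (e 0 * e 2),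
      h2]
    simp only [Form.eval, mul_assoc]

/-! ### Counting -/

theorem IsLeftTransversal.ncard_mul {G : Type*} [Group G] {D : Set G} {K H : Subgroup G}
    (h : IsLeftTransversal D K H) (hK : K ≤ H) : D.ncard * Nat.card K = Nat.card H := by
  rw [← Nat.card_coe_set_eq, ← Nat.card_prod]
  refine Nat.card_congr (Equiv.ofBijective
    (fun p : D × K => (⟨p.1 * p.2, mul_mem (h.1 p.1.2) (hK p.2.2)⟩ : H)) ⟨?_, ?_⟩)
  · rintro ⟨⟨d, hd⟩, ⟨n, hn⟩⟩ ⟨⟨d', hd'⟩, ⟨n', hn'⟩⟩ heq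
    have heq' : d * n = d' * n' := congrArg Subtype.val heq
    obtain rfl : d = d' := (h.2 (d * n) (mul_mem (h.1 hd) (hK hn))).unique
      ⟨hd, by simpa using hn⟩ ⟨hd', by rw [heq']; simpa using hn'⟩
    obtain rfl : n = n' := mul_left_cancel heq'
    rfl
  · rintro ⟨x, hx⟩
    obtain ⟨d, ⟨hd, hn⟩, -⟩ := h.2 x hx
    exact ⟨(⟨d, hd⟩, ⟨_, hn⟩), Subtype.ext (mul_inv_cancel_left d x)⟩

omit [NeZero k] in
theorem ncard_normalForms [Finite (W k)] (D₁ C₁ D₂ : Set (W k)) :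
    (normalForms D₁ C₁ D₂).ncard =
      Nat.card (W k) + D₁.ncard ^ 2 * C₁.ncard + D₂.ncard ^ 2 := by
  have hinv : ∀ D : Set (W k), Nat.card {w : W k // w⁻¹ ∈ D} = D.ncard := fun D =>
    (Nat.card_congr ((Equiv.inv (W k)).subtypeEquiv (p := fun w => w⁻¹ ∈ D) (q := (· ∈ D))
      fun _ => Iff.rfl)).trans (Nat.card_coe_set_eq D)
  let E : normalForms D₁ C₁ D₂ ≃
      (W k ⊕ (D₁ × C₁ × {w : W k // w⁻¹ ∈ D₁})) ⊕ (D₂ × {w : W k // w⁻¹ ∈ D₂}) :=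
    { toFun := fun f => match f with
        | ⟨.typeI r, _⟩ => .inl (.inl r)
        | ⟨.typeII u v w, h⟩ => .inl (.inr (⟨u, h.1⟩, ⟨v, h.2.1⟩, ⟨w, h.2.2⟩))
        | ⟨.typeIII u w, h⟩ => .inr (⟨u, h.1⟩, ⟨w, h.2⟩)
      invFun := fun x => match x with
        | .inl (.inl r) => ⟨.typeI r, trivial⟩
        | .inl (.inr (u, v, w)) => ⟨.typeII u v w, u.2, v.2, w.2⟩
        | .inr (u, w) => ⟨.typeIII u w, u.2, w.2⟩
      left_inv := by rintro ⟨_ | _ | _, h⟩ <;> rfl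
      right_inv := by rintro ((_ | _) | _) <;> rfl }
  rw [← Nat.card_coe_set_eq, Nat.card_congr E, Nat.card_sum, Nat.card_sum, Nat.card_prod,
    Nat.card_prod, Nat.card_prod, hinv, hinv, Nat.card_coe_set_eq, Nat.card_coe_set_eq,
    Nat.card_coe_set_eq]
  ring

theorem index_eq_ncard_range {G X : Type*} [Group G] (K : Subgroup G) (f : G → X)
    (hf : ∀ g g', f g = f g' ↔ g⁻¹ * g' ∈ K) : K.index = (Set.range f).ncard := by
  rw [Subgroup.index, ← Nat.card_coe_set_eq]
  refine Nat.card_congr (Equiv.ofBijective (Quotient.lift (fun g => (⟨f g, g, rfl⟩ : Set.range f))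
    fun a b hab => Subtype.ext ((hf a b).2 (QuotientGroup.leftRel_apply.1 hab))) ⟨?_, ?_⟩)
  · rintro ⟨a⟩ ⟨b⟩ hab
    exact Quotient.sound (QuotientGroup.leftRel_apply.2 ((hf a b).1 (congrArg Subtype.val hab)))
  · rintro ⟨_, g, rfl⟩
    exact ⟨Quotient.mk _ g, rfl⟩

end reduction

/-! ### Orbits by search -/

section exploration

/-- Breadth-first search: everything that is reached from `front` by at most `n` steps. -/
def explore {α : Type*} [BEq α] (gens : List (α → α)) : ℕ → List α → List α → List α
  | 0, seen, _ => seen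
  | n + 1, seen, front =>
    let new := (front.flatMap fun x => gens.map fun g => g x).foldl
      (fun acc y => if acc.contains y || seen.contains y then acc else y :: acc) []
    explore gens n (new ++ seen) new

/-- Only soundness of the search is needed: that a particular point is reached is established by
evaluating the list, so the bound on the number of rounds carries no proof obligation. -/
theorem forall_mem_explore {α : Type*} [BEq α] {gens : List (α → α)} {P : α → Prop}
    (hP : ∀ g ∈ gens, ∀ x, P x → P (g x)) (n : ℕ) (seen front : List α)
    (hs : ∀ x ∈ seen, P x) (hf : ∀ x ∈ front, P x) : ∀ x ∈ explore gens n seen front, P x := by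
  induction n generalizing seen front with
  | zero => exact hs
  | succ n ih =>
    have fold : ∀ (l acc : List α), (∀ x ∈ l, P x) → (∀ x ∈ acc, P x) → ∀ x ∈ l.foldl
        (fun acc y => if acc.contains y || seen.contains y then acc else y :: acc) acc, P x := by
      intro l
      induction l with
      | nil => exact fun acc _ h => h
      | cons a l ihl =>
        intro acc hl hacc
        rw [List.foldl_cons]
        refine ihl _ (fun x hx => hl x (List.mem_cons_of_mem _ hx)) ?_
        split_ifs
        · exact hacc
        · intro x hx
          rcases List.mem_cons.1 hx with rfl | hx
          · exact hl _ List.mem_cons_self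
          · exact hacc x hx
    have hnew := fold (front.flatMap fun x => gens.map fun g => g x) [] (by
      intro x hx
      obtain ⟨y, hy, hx⟩ := List.mem_flatMap.1 hx
      obtain ⟨g, hg, rfl⟩ := List.mem_map.1 hx
      exact hP g hg y (hf y hy)) (by simp)
    refine ih _ _ (fun x hx => ?_) hnew
    rcases List.mem_append.1 hx with hx | hx
    · exact hnew x hx
    · exact hs x hx

end exploration

/-! ### Equality of words, and stabilizers of vectors -/

section stabilizers

variable {k : ℕ}

theorem wordProd_append (l l' : List (Fin k)) :
    wordProd (l ++ l') = wordProd l * wordProd l' := by simp [wordProd]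

theorem wordProd_reverse (l : List (Fin k)) : wordProd l.reverse = (wordProd l)⁻¹ := by
  simp only [wordProd, List.prod_inv_reverse, List.map_reverse, List.map_map]
  congr 2
  exact List.map_congr_left fun i _ => (s_inv i).symm

/-- By faithfulness, an identity between words in the group becomes a finite comparison of table
positions and signs. -/
theorem ValidTable.wordProd_ext (H : ValidTable k) (F : FiniteRoots k) {l l' : List (Fin k)}
    (h : ∀ i : Fin k, wordAct l (simpleIdx i, false) = wordAct l' (simpleIdx i, false)) :
    wordProd l = wordProd l' := by
  refine F.ext fun i => ?_
  rw [← H.root_simple, H.geom_wordProd_root _ (H.simple_lt i),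
    H.geom_wordProd_root _ (H.simple_lt i), h]

def nodupCheck (k : ℕ) : Bool :=
  (List.range (numRoots k)).all fun n =>
    ((List.range k).any fun i => coord n i != (0, 0)) &&
    (List.range (numRoots k)).all fun m =>
      n == m || (List.range k).any fun i => coord n i != coord m i

theorem nodupCheck_three : nodupCheck 3 = true := by decide +kernel

theorem nodupCheck_four : nodupCheck 4 = true := by decide +kernel

theorem root_injOn (h : nodupCheck k = true) : Set.InjOn (root k) {x | x.1 < numRoots k} := by
  simp only [nodupCheck, List.all_eq_true, List.mem_range, Bool.and_eq_true, Bool.or_eq_true,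
    beq_iff_eq, List.any_eq_true, bne_iff_ne, ne_eq] at h
  have hpos : ∀ {n m}, n < numRoots k → m < numRoots k → posRoot k n = posRoot k m → n = m := by
    intro n m hn hm hnm
    refine ((h n hn).2 m hm).resolve_right ?_
    rintro ⟨i, hi, hne⟩
    exact hne (toReal_injective (congrFun hnm ⟨i, hi⟩))
  have hneg : ∀ {n m}, n < numRoots k → posRoot k n ≠ -posRoot k m := by
    intro n m hn hnm
    obtain ⟨i, hi, hne⟩ := (h n hn).1
    apply hne
    apply toReal_injective
    have h1 : toReal (coord n i) = -toReal (coord m i) := congrFun hnm ⟨i, hi⟩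
    have h2 := toReal_nonneg (coord n i)
    have h3 := toReal_nonneg (coord m i)
    have h4 : toReal (0, 0) = 0 := by simp [toReal]
    linarith
  rintro ⟨n, b⟩ hn ⟨m, c⟩ hm hnm
  cases b <;> cases c <;> simp only [root, cond_true, cond_false] at hnm
  · exact congrArg (·, false) (hpos hn hm hnm)
  · exact (hneg hn hnm).elim
  · exact (hneg hm hnm.symm).elim
  · exact congrArg (·, true) (hpos hn hm (neg_injective hnm))

/-- The stabilizer of a vector. -/
noncomputable def fixer (v : V k) : Subgroup (W k) where
  carrier := {w | geom k w v = v}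
  one_mem' := by simp
  mul_mem' {a b} ha hb := by
    simp only [Set.mem_ofPred_eq] at ha hb ⊢
    rw [geom_mul_apply, hb, ha]
  inv_mem' {a} ha := by
    simp only [Set.mem_ofPred_eq] at ha ⊢
    conv_lhs => rw [← ha, geom_inv_apply]

theorem mem_fixer {v : V k} {w : W k} : w ∈ fixer v ↔ geom k w v = v := Iff.rfl

/-- If g moves v into the closed chamber, the stabilizer of v is the g-conjugate of a parabolic
subgroup, so its generators are the g⁻¹ sᵢ g with sᵢ fixing gv. -/
theorem FiniteRoots.fixer_le (F : FiniteRoots k) (g : W k) (v : V k)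
    (hdom : ∀ i, 0 ≤ ip k (geom k g v) (simpleRoot i)) {K : Subgroup (W k)}
    (hK : ∀ i, ip k (geom k g v) (simpleRoot i) = 0 → g⁻¹ * s i * g ∈ K) : fixer v ≤ K := by
  intro w hw
  have h1 : geom k (g * w * g⁻¹) (geom k g v) = geom k g v := by
    rw [geom_mul_apply, geom_inv_apply, geom_mul_apply, mem_fixer.1 hw]
  have h2 := F.mem_closure_of_dominant hdom _ h1
  have h3 : Subgroup.closure (s '' {i : Fin k | ip k (geom k g v) (simpleRoot i) = 0}) ≤
      K.comap (MulAut.conj g⁻¹).toMonoidHom := by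
    rw [Subgroup.closure_le]
    rintro _ ⟨i, hi, rfl⟩
    simpa using hK i hi
  simpa [mul_assoc] using h3 h2

theorem mem_rootStabilizer_singleton {v : V k} {w : W k} :
    w ∈ rootStabilizer {v} ↔ geom k w v = v ∨ geom k w v = -v := by
  change geom k w '' ({v} ∪ -{v}) = {v} ∪ -{v} ↔ _
  have h : ({v} ∪ -{v} : Set (V k)) = {v, -v} := by
    rw [Set.neg_singleton]; rfl
  rw [h, Set.image_pair, map_neg]
  constructor
  · intro h
    have : geom k w v ∈ ({v, -v} : Set (V k)) := h ▸ Set.mem_insert _ _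
    simpa using this
  · rintro (h | h) <;> rw [h]
    rw [neg_neg, Set.pair_comm]

theorem geom_s_self (i : Fin k) : geom k (s i) (simpleRoot i) = -simpleRoot i := by
  have := geom_mul_s_self 1 i
  rwa [one_mul, map_one] at this

theorem mem_or_mul_mem {K : Subgroup (W k)} {i : Fin k} (hK : fixer (simpleRoot i) ≤ K)
    {w : W k} (hw : w ∈ rootStabilizer {simpleRoot i}) : w ∈ K ∨ w * s i ∈ K := by
  rcases mem_rootStabilizer_singleton.1 hw with h | h
  · exact Or.inl (hK h)
  · refine Or.inr (hK ?_)
    rw [mem_fixer, geom_mul_apply, geom_s_self, map_neg, h, neg_neg]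

theorem card_rootStabilizer_singleton (i : Fin k) :
    Nat.card (rootStabilizer {(simpleRoot i : V k)}) =
      2 * Nat.card (fixer (simpleRoot i : V k)) := by
  have hne : (simpleRoot i : V k) ≠ -simpleRoot i := by
    intro h
    have := congrFun h i
    norm_num [simpleRoot] at this
  have hs : s i ∉ fixer (simpleRoot i : V k) := by
    rw [mem_fixer, geom_s_self]; exact hne.symm
  have h1s : (1 : W k) ≠ s i := by rintro h; exact hs (h ▸ one_mem _)
  have hle : fixer (simpleRoot i : V k) ≤ rootStabilizer {simpleRoot i} := fun w hw =>
    mem_rootStabilizer_singleton.2 (Or.inl hw)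
  have hsm : s i ∈ rootStabilizer {(simpleRoot i : V k)} :=
    mem_rootStabilizer_singleton.2 (Or.inr (geom_s_self i))
  have ht : IsLeftTransversal {1, s i} (fixer (simpleRoot i : V k))
      (rootStabilizer {simpleRoot i}) := by
    refine ⟨?_, fun x hx => ?_⟩
    · rintro _ (rfl | rfl)
      · exact one_mem _
      · exact hsm
    · rcases mem_rootStabilizer_singleton.1 hx with h | h
      · refine ⟨1, ⟨Or.inl rfl, by simpa [mem_fixer] using h⟩, ?_⟩
        rintro _ ⟨rfl | rfl, hd⟩
        · rfl
        · exfalso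
          rw [mem_fixer, geom_mul_apply, h, s_inv, geom_s_self] at hd
          exact hne hd.symm
      · refine ⟨s i, ⟨Or.inr rfl, ?_⟩, ?_⟩
        · rw [mem_fixer, geom_mul_apply, h, s_inv, map_neg, geom_s_self, neg_neg]
        · rintro _ ⟨rfl | rfl, hd⟩
          · exfalso
            rw [mem_fixer, geom_mul_apply, h, inv_one, map_one] at hd
            exact hne hd.symm
          · rfl
  rw [← ht.ncard_mul hle, Set.ncard_pair h1s]

theorem card_closure_pair {G : Type*} [Group G] {a b : G} (ha : a * a = 1) (hb : b * b = 1)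
    (hab : a * b = b * a) (ha1 : a ≠ 1) (hb1 : b ≠ 1) (hne : a ≠ b) :
    Nat.card (Subgroup.closure {a, b}) = 4 := by
  let K : Subgroup G :=
    { carrier := {1, a, b, a * b}
      one_mem' := by simp
      mul_mem' := by
        have h2 : b * (a * b) = a := by rw [hab, ← mul_assoc, hb, one_mul]
        have h3 : a * (a * b) = b := by rw [← mul_assoc, ha, one_mul]
        rintro _ _ (rfl | rfl | rfl | rfl) (rfl | rfl | rfl | rfl) <;>
          simp [mul_assoc, ha, hb, h2, h3, ← hab]
      inv_mem' := by
        have ia : a⁻¹ = a := inv_eq_of_mul_eq_one_left ha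
        have ib : b⁻¹ = b := inv_eq_of_mul_eq_one_left hb
        rintro _ (rfl | rfl | rfl | rfl) <;> simp [ia, ib, ← hab] }
  have hK : Subgroup.closure {a, b} = K := by
    refine le_antisymm (by rw [Subgroup.closure_le]; rintro _ (rfl | rfl) <;> simp [K]) ?_
    have ma : a ∈ Subgroup.closure {a, b} := Subgroup.subset_closure (by simp)
    have mb : b ∈ Subgroup.closure {a, b} := Subgroup.subset_closure (by simp)
    rintro _ (rfl | rfl | rfl | rfl)
    · exact one_mem _
    · exact ma
    · exact mb
    · exact mul_mem ma mb
  have h4 : ({1, a, b, a * b} : Set G).ncard = 4 := by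
    have hab1 : a * b ≠ 1 := fun h => hne (by rw [← mul_one a, ← hb, ← mul_assoc, h, one_mul])
    rw [Set.ncard_insert_of_notMem, Set.ncard_insert_of_notMem, Set.ncard_pair]
    · simpa using ha1
    · simp [hne, hb1]
    · simp [ha1.symm, hb1.symm, hab1.symm]
  rw [hK, ← h4, ← Nat.card_coe_set_eq]
  rfl

end stabilizers

/-! ### Transitivity on roots and the products e₁ w e₁ -/

section words

variable {k : ℕ} [NeZero k]

def rot135Word (k : ℕ) [NeZero k] : List (Fin k) := [1, 0, 1, 0, 2, 1]

def r5Word (k : ℕ) [NeZero k] : List (Fin k) := rot135Word k ++ 0 :: (rot135Word k).reverse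

omit [NeZero k] in
theorem wordProd_nil : wordProd ([] : List (Fin k)) = 1 := rfl

omit [NeZero k] in
theorem wordProd_cons (i : Fin k) (l : List (Fin k)) : wordProd (i :: l) = s i * wordProd l := by
  simp [wordProd]

omit [NeZero k] in
theorem wordProd_singleton (i : Fin k) : wordProd [i] = s i := by simp [wordProd]

theorem wordProd_rot135Word : wordProd (rot135Word k) = rot135 k := by
  simp [wordProd, rot135Word, rot135, mul_assoc]

theorem wordProd_r5Word : wordProd (r5Word k) = r5 k := by
  rw [r5Word, wordProd_append, wordProd_cons, wordProd_reverse, wordProd_rot135Word, r5_eq,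
    mul_assoc]

/-- The facts about the type `H_k` that have been checked on the table of roots. -/
structure IsH (k : ℕ) [NeZero k] : Prop where
  table : ValidTable k
  roots : FiniteRoots k
  nodup : nodupCheck k = true
  start : StartsWithH3 k

theorem isH_three : IsH 3 :=
  ⟨validTable_three, finiteRoots_three, nodupCheck_three, by decide, by decide⟩

theorem isH_four : IsH 4 :=
  ⟨validTable_four, finiteRoots_four, nodupCheck_four, by decide, by decide⟩

namespace IsH

variable (H : IsH k)
include H

theorem root_zero : root k (0, false) = simpleRoot 0 := by
  have := H.table.root_simple 0
  simpa [simpleIdx] using this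

theorem zero_lt : 0 < numRoots k := by
  have := H.table.simple_lt 0
  simpa [simpleIdx] using this

theorem geom_wordProd_simpleRoot_zero (l : List (Fin k)) :
    geom k (wordProd l) (simpleRoot 0) = root k (wordAct l (0, false)) := by
  rw [← H.root_zero, H.table.geom_wordProd_root l H.zero_lt]

theorem exists_root_eq (w : W k) :
    ∃ x : ℕ × Bool, x.1 < numRoots k ∧ geom k w (simpleRoot 0) = root k x := by
  rw [← H.root_zero]; exact H.table.exists_geom_root w H.zero_lt

omit H in
/-- Whether all roots are conjugate under the group. -/
def transitiveCheck (k : ℕ) : Bool :=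
  let L := explore ((List.finRange k).map fun i : Fin k => simpleAct i) 60 [(0, false)] [(0, false)]
  (List.range (numRoots k)).all fun n => L.contains (n, false) && L.contains (n, true)

omit H in
theorem transitiveCheck_three : transitiveCheck 3 = true := by decide +kernel

omit H in
theorem transitiveCheck_four : transitiveCheck 4 = true := by decide +kernel

/-- Orbit counting: the orbit of β₁ consists of all table rows with both signs. -/
theorem index_fixer (h : transitiveCheck k = true) :
    (fixer (simpleRoot 0 : V k)).index = 2 * numRoots k := by
  rw [index_eq_ncard_range _ fun w : W k => geom k w (simpleRoot 0)]
  · have hr : Set.range (fun w : W k => geom k w (simpleRoot 0)) =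
        root k '' ((Finset.range (numRoots k) ×ˢ (Finset.univ : Finset Bool) :
          Finset (ℕ × Bool)) : Set (ℕ × Bool)) := by
      ext v
      constructor
      · rintro ⟨w, rfl⟩
        obtain ⟨x, hx, h⟩ := H.exists_root_eq w
        exact ⟨x, by simpa using hx, h.symm⟩
      · rintro ⟨⟨n, b⟩, hx, rfl⟩
        have hn : n < numRoots k := by simpa using hx
        simp only [transitiveCheck, List.all_eq_true, List.mem_range, Bool.and_eq_true,
          List.contains_iff_mem] at h
        have key := forall_mem_explore
          (P := fun x : ℕ × Bool => x.1 < numRoots k ∧ ∃ w, geom k w (simpleRoot 0) = root k x)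
          (gens := (List.finRange k).map fun i : Fin k => simpleAct i) (by
            intro g hg x hx
            obtain ⟨i, -, rfl⟩ := List.mem_map.1 hg
            obtain ⟨hx, w, hw⟩ := hx
            refine ⟨H.table.perm_lt i _ hx, s i * w, ?_⟩
            rw [geom_mul_apply, hw, H.table.geom_s_root i hx]) 60 [(0, false)] [(0, false)]
          (by simpa using ⟨H.zero_lt, 1, by simpa using H.root_zero.symm⟩)
          (by simpa using ⟨H.zero_lt, 1, by simpa using H.root_zero.symm⟩)
        cases b
        · exact (key _ (h n hn).1).2
        · exact (key _ (h n hn).2).2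
    rw [hr, Set.InjOn.ncard_image, Set.ncard_coe_finset, Finset.card_product,
      Finset.card_range, Finset.card_univ, Fintype.card_bool, mul_comm]
    exact (root_injOn H.nodup).mono fun x hx => by simpa using hx
  · intro g g'
    rw [mem_fixer, geom_mul_apply]
    constructor
    · intro h; rw [← h, geom_inv_apply]
    · intro h; rw [← geom_apply_inv g (geom k g' _), h]

theorem ext {l l' : List (Fin k)}
    (h : ∀ i : Fin k, wordAct l (simpleIdx i, false) = wordAct l' (simpleIdx i, false)) :
    wordProd l = wordProd l' :=
  H.table.wordProd_ext H.roots h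

end IsH

/-! ### The elements `e₁ w e₁` -/

/-- Words for generators of the stabilizer of `±β₁`. -/
def stabWords (k : ℕ) [NeZero k] : List (List (Fin k)) :=
  r5Word k :: ((List.finRange k).filter fun i => decide (i ≠ 1)).map fun i => [i]

def wordPerm (l : List (Fin k)) (n : ℕ) : ℕ := (wordAct l (n, false)).1

/-- Positive roots that are conjugate, up to sign, under the stabilizer of `±β₁` to the image of
`β₁` under one of the given words. -/
def orbitOf (k : ℕ) [NeZero k] (seeds : List (List (Fin k))) : List ℕ :=
  explore ((stabWords k).map wordPerm) 20 (seeds.map (wordPerm · 0)) (seeds.map (wordPerm · 0))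

/-- The images of β₁ have inner products 2, -1/φ, φ, 1 with β₁, which are all nonzero values between
roots up to sign. -/
def leftSeeds (k : ℕ) [NeZero k] : List (List (Fin k)) :=
  [[], [1], [1, 0, 1], rot135Word k ++ 1 :: (rot135Word k).reverse]

/-- The images of β₁ are β₅ and β₃. Both are needed for k = 3, where they lie in different orbits of
the stabilizer of ±β₁. -/
def twoSeeds (k : ℕ) [NeZero k] : List (List (Fin k)) :=
  [rot135Word k, (rot135Word k).reverse]

def orbitCheck (k : ℕ) [NeZero k] : Bool :=
  let A := orbitOf k (leftSeeds k)
  let B := orbitOf k (twoSeeds k)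
  (List.range (numRoots k)).all fun n =>
    A.contains n || (B.contains n && n != 0 && perm 0 n == n)

theorem orbitCheck_three : orbitCheck 3 = true := by decide +kernel

theorem orbitCheck_four : orbitCheck 4 = true := by decide +kernel

omit [NeZero k] in
theorem root_eq_or (n : ℕ) (b : Bool) (v : V k) :
    (v = root k (n, b) ∨ v = -root k (n, b)) ↔ v = posRoot k n ∨ v = -posRoot k n := by
  cases b <;> simp [root, or_comm]

namespace IsH

variable (H : IsH k)
include H

theorem stabWords_mem {l : List (Fin k)} (hl : l ∈ stabWords k) :
    wordProd l ∈ centralizerE k := by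
  rcases List.mem_cons.1 hl with rfl | hl
  · rw [wordProd_r5Word]; exact r5_mem_centralizerE H.start
  · obtain ⟨i, hi, rfl⟩ := List.mem_map.1 hl
    have hi1 : i ≠ 1 := by simpa using hi
    rw [wordProd_singleton]
    by_cases h0 : i = 0
    · rw [h0]; exact s_zero_mem_centralizerE
    · apply s_mem_centralizerE
      have h1k : 1 < k := by
        have hb := H.start.bond
        rcases Nat.lt_or_ge 1 k with h | h
        · exact h
        · have : Subsingleton (Fin k) := Fin.subsingleton_iff_le_one.2 h
          exact absurd (Subsingleton.elim i 0) h0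
      have h0' : i.val ≠ 0 := fun h => h0 (Fin.ext (by simpa using h))
      have h1' : i.val ≠ 1 := fun h => hi1 (Fin.ext (by
        simp [h, Nat.mod_eq_of_lt h1k]))
      change (if 0 = i then 1 else if (0 : Fin k).val + i.val = 1 then 5
        else if (0 : Fin k).val + 1 = i.val ∨ i.val + 1 = (0 : Fin k).val then 3 else 2) = 2
      rw [Fin.val_zero, if_neg (Ne.symm h0), if_neg (by omega), if_neg (by omega)]

/-- A property invariant under multiplication by the centralizer on both sides depends only on the
orbit of ±wβ₁: right multiplication accounts for all w with the same image as a seed, left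
multiplication moves along the orbit. -/
theorem of_mem_orbitOf (hN : fixer (simpleRoot 0) ≤ centralizerE k) {Q : W k → Prop}
    (hl : ∀ w, ∀ n ∈ centralizerE k, Q w → Q (n * w))
    (hr : ∀ w, ∀ n ∈ centralizerE k, Q w → Q (w * n))
    {seeds : List (List (Fin k))} (hs : ∀ l ∈ seeds, Q (wordProd l)) :
    ∀ n ∈ orbitOf k seeds, ∀ w, (geom k w (simpleRoot 0) = posRoot k n ∨
      geom k w (simpleRoot 0) = -posRoot k n) → Q w := by
  have hseed : ∀ n ∈ seeds.map (wordPerm · 0), n < numRoots k ∧ ∀ w,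
      (geom k w (simpleRoot 0) = posRoot k n ∨ geom k w (simpleRoot 0) = -posRoot k n) → Q w := by
    intro n hn
    obtain ⟨l, hl', rfl⟩ := List.mem_map.1 hn
    refine ⟨H.table.wordAct_lt l H.zero_lt, fun w hw => ?_⟩
    have hmem : (wordProd l)⁻¹ * w ∈ rootStabilizer {(simpleRoot 0 : V k)} := by
      rw [mem_rootStabilizer_singleton, geom_mul_apply]
      rw [wordPerm, ← root_eq_or _ (wordAct l (0, false)).2, Prod.mk.eta,
        ← H.geom_wordProd_simpleRoot_zero] at hw
      rcases hw with h | h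
      · left; rw [h, geom_inv_apply]
      · right; rw [h, map_neg, geom_inv_apply]
    have hc : (wordProd l)⁻¹ * w ∈ centralizerE k := by
      rcases mem_or_mul_mem hN hmem with h | h
      · exact h
      · have := mul_mem h (s_zero_mem_centralizerE (k := k))
        rwa [mul_assoc _ (s 0), s_mul_s, mul_one] at this
    have := hr _ _ hc (hs l hl')
    rwa [mul_inv_cancel_left] at this
  intro n hn
  refine (forall_mem_explore (P := fun n => n < numRoots k ∧ ∀ w,
    (geom k w (simpleRoot 0) = posRoot k n ∨ geom k w (simpleRoot 0) = -posRoot k n) → Q w)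
    ?_ 20 _ _ hseed hseed n hn).2
  rintro _ hg m ⟨hm, hQ⟩
  obtain ⟨l, hl', rfl⟩ := List.mem_map.1 hg
  refine ⟨H.table.wordAct_lt l (x := (m, false)) hm, fun w hw => ?_⟩
  have hc := H.stabWords_mem hl'
  have := hl _ _ hc (hQ ((wordProd l)⁻¹ * w) ?_)
  · rwa [mul_inv_cancel_left] at this
  · rw [wordPerm, ← root_eq_or _ (wordAct l (m, false)).2, Prod.mk.eta,
      ← H.table.geom_wordProd_root l (x := (m, false)) hm] at hw
    rw [geom_mul_apply]
    rcases hw with h | h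
    · left; rw [h, geom_inv_apply]; rfl
    · right; rw [h, map_neg, geom_inv_apply]; rfl

theorem collapses (hN : fixer (simpleRoot 0) ≤ centralizerE k) (hO : orbitCheck k = true)
    (w : W k) : CollapsesLeft w ∨
      (CollapsesTwo w ∧ ip k (geom k w (simpleRoot 0)) (simpleRoot 0) = 0) := by
  have hA := H.of_mem_orbitOf hN (Q := CollapsesLeft) (fun _ _ hn h => h.mul_left hn)
    (fun _ _ hn h => h.mul_right hn) (seeds := leftSeeds k) (by
      intro l hl
      simp only [leftSeeds, List.mem_cons, List.not_mem_nil, or_false] at hl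
      rcases hl with rfl | rfl | rfl | rfl
      · exact collapsesLeft_one
      · rw [wordProd_singleton]; exact collapsesLeft_s_one
      · simpa [wordProd, mul_assoc] using collapsesLeft_s_one_zero_one (k := k)
      · rw [wordProd_append, wordProd_cons, wordProd_reverse, wordProd_rot135Word, ← mul_assoc]
        exact collapsesLeft_of_eq (e_rot135_s_rot135_inv_e H.start))
  have hB := H.of_mem_orbitOf hN (Q := CollapsesTwo) (fun _ _ hn h => h.mul_left hn)
    (fun _ _ hn h => h.mul_right hn) (seeds := twoSeeds k) (by
      intro l hl
      simp only [twoSeeds, List.mem_cons, List.not_mem_nil, or_false] at hl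
      rcases hl with rfl | rfl
      · rw [wordProd_rot135Word]; exact collapsesTwo_of_eq (e_rot135_e H.start)
      · rw [wordProd_reverse, wordProd_rot135Word]
        exact collapsesTwo_of_eq (e_rot135_inv_e H.start))
  obtain ⟨⟨n, b⟩, hn, hw⟩ := H.exists_root_eq w
  have hw' := (root_eq_or n b _).1 (Or.inl hw)
  simp only [orbitCheck, List.all_eq_true, List.mem_range, Bool.or_eq_true, Bool.and_eq_true,
    List.contains_iff_mem, beq_iff_eq, bne_iff_ne, ne_eq] at hO
  rcases hO n hn with h | ⟨⟨h, hn0⟩, hp⟩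
  · exact Or.inl (hA n h w hw')
  · refine Or.inr ⟨hB n h w hw', ?_⟩
    -- The root at position n is fixed by r₁, with its sign because n ≠ 0, and is therefore
    -- orthogonal to β₁.
    have hfix : geom k (s 0) (geom k w (simpleRoot 0)) = geom k w (simpleRoot 0) := by
      rw [hw, H.table.geom_s_root 0 hn]
      have hn0' : (n == 0) = false := by simpa using hn0
      simp [simpleAct, hp, simpleIdx, hn0']
    rw [geom_s, reflection_apply, sub_eq_self] at hfix
    refine (smul_eq_zero.1 hfix).resolve_right ?_
    simpa using geom_simpleRoot_ne_zero (1 : W k) 0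

end IsH

end words

/-! ### Stabilizers of orthogonal frames -/

section frames

variable {k : ℕ} [NeZero k]

theorem card_eq_ncard_image_mul {G X : Type*} [Group G] {N K : Subgroup G} (hKN : K ≤ N)
    (f : G → X) (hf : ∀ g g', f g = f g' ↔ g⁻¹ * g' ∈ K) :
    Nat.card N = (f '' N).ncard * Nat.card K := by
  have h1 := index_eq_ncard_range (K.subgroupOf N) (fun g : N => f g) fun g g' => by
    rw [hf]; rfl
  have h2 : Set.range (fun g : N => f g) = f '' N := by
    ext x; simp
  rw [← Subgroup.index_mul_card (K.subgroupOf N), h1, h2,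
    Nat.card_congr (Subgroup.subgroupOfEquivOfLe hKN).toEquiv]

omit [NeZero k] in
theorem geom_eq_geom_iff (g g' : W k) (v : V k) :
    geom k g v = geom k g' v ↔ g⁻¹ * g' ∈ fixer v := by
  rw [mem_fixer, geom_mul_apply]
  constructor
  · intro h; rw [← h, geom_inv_apply]
  · intro h; rw [← geom_apply_inv g (geom k g' _), h]

/-- The positive roots at the given positions. -/
noncomputable def frame (k : ℕ) (I : List ℕ) : Set (V k) := posRoot k '' {n | n ∈ I}

omit [NeZero k] in
theorem mem_frame_union {I : List ℕ} {v : V k} :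
    v ∈ frame k I ∪ -frame k I ↔ ∃ x : ℕ × Bool, x.1 ∈ I ∧ v = root k x := by
  constructor
  · rintro (⟨n, hn, rfl⟩ | ⟨n, hn, h⟩)
    · exact ⟨(n, false), hn, rfl⟩
    · exact ⟨(n, true), hn, by simp [root, h]⟩
  · rintro ⟨⟨n, b⟩, hn, rfl⟩
    cases b
    · exact Or.inl ⟨n, hn, rfl⟩
    · exact Or.inr ⟨n, hn, by simp [root]⟩

omit [NeZero k] in
theorem finite_frame_union (I : List ℕ) : (frame k I ∪ -frame k I).Finite := by
  have h : (frame k I).Finite := (List.finite_toSet I).image _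
  exact h.union h.neg

omit [NeZero k] in
theorem mem_rootStabilizer_of_mapsTo {I : List ℕ} {w : W k}
    (h : ∀ n ∈ I, geom k w (posRoot k n) ∈ frame k I ∪ -frame k I) :
    w ∈ rootStabilizer (frame k I) := by
  change geom k w '' _ = _
  refine Set.eq_of_subset_of_ncard_le ?_ ?_ (finite_frame_union I)
  · rintro _ ⟨v, hv, rfl⟩
    rcases hv with ⟨n, hn, rfl⟩ | ⟨n, hn, hv⟩
    · exact h n hn
    · have := h n hn
      rw [hv, map_neg] at this
      rcases this with h' | h'
      · exact Or.inr h'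
      · exact Or.inl (by simpa using h')
  · rw [Set.ncard_image_of_injective _ (geom_injective w)]

omit [NeZero k] in
theorem geom_mem_frame_union {I : List ℕ} {w : W k} (hw : w ∈ rootStabilizer (frame k I)) {n : ℕ}
    (hn : n ∈ I) : ∃ x : ℕ × Bool, x.1 ∈ I ∧ geom k w (posRoot k n) = root k x := by
  rw [← mem_frame_union]
  have hw' : geom k w '' (frame k I ∪ -frame k I) = frame k I ∪ -frame k I := hw
  rw [← hw']
  exact ⟨_, Or.inl ⟨n, hn, rfl⟩, rfl⟩

namespace IsH

variable (H : IsH k)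
include H

theorem wordProd_mem_rootStabilizer {I : List ℕ} (hI : ∀ n ∈ I, n < numRoots k)
    {l : List (Fin k)} (hl : ∀ n ∈ I, wordPerm l n ∈ I) :
    wordProd l ∈ rootStabilizer (frame k I) :=
  mem_rootStabilizer_of_mapsTo fun n hn => mem_frame_union.2
    ⟨wordAct l (n, false), hl n hn, H.table.geom_wordProd_root l (x := (n, false)) (hI n hn)⟩

theorem wordProd_ne {l l' : List (Fin k)} {x : ℕ × Bool} (hx : x.1 < numRoots k)
    (h : wordAct l x ≠ wordAct l' x) : wordProd l ≠ wordProd l' := by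
  intro heq
  apply h
  have h1 := H.table.geom_wordProd_root l hx
  rw [heq, H.table.geom_wordProd_root l' hx] at h1
  exact (root_injOn H.nodup (H.table.wordAct_lt l' hx) (H.table.wordAct_lt l hx) h1).symm

theorem s_two_mem_fixer : s 2 ∈ fixer (simpleRoot 0 : V k) := by
  have h : gram k 0 2 = 0 := by simp [gram, H.start.noBond]
  rw [mem_fixer, geom_s, reflection_apply, ip_simple, h, zero_smul, sub_zero]

theorem card_W (hT : transitiveCheck k = true) :
    Nat.card (W k) = Nat.card (fixer (simpleRoot 0 : V k)) * (2 * numRoots k) := by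
  rw [← H.index_fixer hT, Subgroup.card_mul_index]

omit H in
-- A root orthogonal to all simple roots would be orthogonal to itself, but its squared length is 2.
theorem ip_self_ne_zero (w : W k) (h : ∀ i, ip k (geom k w (simpleRoot 0)) (simpleRoot i) = 0) :
    False := by
  have h1 : ip k (geom k w (simpleRoot 0)) (geom k w (simpleRoot 0)) = 2 := by
    rw [ip_geom, ip_simple, gram_self]
  have h2 : ∀ v : V k, ip k (geom k w (simpleRoot 0)) v = 0 := by
    intro v
    have : v = ∑ i, v i • (simpleRoot i : V k) := by
      ext j; simp [simpleRoot, Pi.single_apply]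
    rw [this, map_sum]
    exact Finset.sum_eq_zero fun i _ => by rw [map_smul, h, smul_zero]
  rw [h2] at h1
  norm_num at h1

omit H in
-- The coefficient of β₂ in β₅ is 2φ ≠ 0, so β₂ lies in the span of β₁, β₃, β₅.
theorem ip_one_eq_zero {v : V k} (h0 : ip k v (simpleRoot 0) = 0) (h2 : ip k v (simpleRoot 2) = 0)
    (h5 : ip k v (beta5 k) = 0) : ip k v (simpleRoot 1) = 0 := by
  rw [beta5, map_add, map_add, map_smul, map_smul, map_smul, h0, h2] at h5
  have := Real.goldenRatio_ne_zero
  simpa [this] using h5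

end IsH

end frames

/-! ### Type H₃: the stabilizer of β₁ and the group order -/

section three

theorem beta5_three : beta5 3 = posRoot 3 14 := by
  ext i
  fin_cases i <;> simp [beta5, posRoot, coord, rootTable, toReal, simpleRoot, add_comm]

theorem rot135_three_zero : geom 3 (rot135 3) (simpleRoot 0) = beta5 3 := by
  rw [← wordProd_rot135Word, isH_three.geom_wordProd_simpleRoot_zero, beta5_three,
    show wordAct (rot135Word 3) (0, false) = (14, false) by decide +kernel]
  rfl

theorem rot135_inv_three_zero : geom 3 (rot135 3)⁻¹ (simpleRoot 0) = simpleRoot 2 := by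
  rw [← wordProd_rot135Word, ← wordProd_reverse, isH_three.geom_wordProd_simpleRoot_zero,
    ← isH_three.table.root_simple,
    show wordAct (rot135Word 3).reverse (0, false) = (simpleIdx (2 : Fin 3), false) by
      decide +kernel]

theorem r5_three_mem_fixer : r5 3 ∈ fixer (simpleRoot 0 : V 3) := by
  rw [mem_fixer, ← wordProd_r5Word, isH_three.geom_wordProd_simpleRoot_zero,
    show wordAct (r5Word 3) (0, false) = (0, false) by decide +kernel, isH_three.root_zero]

theorem ip_beta5_three (i : Fin 3) :
    ip 3 (beta5 3) (simpleRoot i) = if i = 1 then Real.goldenRatio⁻¹ else 0 := by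
  have h := Real.goldenRatio_sq
  have h' : (Real.goldenRatio)⁻¹ = Real.goldenRatio - 1 := by
    rw [inv_eq_iff_eq_inv, eq_comm]
    apply inv_eq_of_mul_eq_one_left
    linear_combination h
  rw [ip_eq, gram_three, h', beta5]
  clear h'
  generalize Real.goldenRatio = φ at *
  fin_cases i <;> simp [Fin.sum_univ_three, simpleRoot] <;>
    first | ring1 | linear_combination (-(φ + 1)) * h

/-- `rot135` carries β₁ to the dominant root β₅, whose stabilizer is ⟨r₁, r₃⟩; conjugating back
turns r₁ into r₃ and r₃ into r₅. -/
theorem fixer_three : fixer (simpleRoot 0 : V 3) = Subgroup.closure {s 2, r5 3} := by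
  refine le_antisymm (finiteRoots_three.fixer_le (rot135 3) _ ?_ ?_) ?_
  · intro i
    rw [rot135_three_zero, ip_beta5_three]
    have := Real.goldenRatio_pos
    split_ifs <;> positivity
  · intro i hi
    rw [rot135_three_zero, ip_beta5_three] at hi
    have hne := inv_ne_zero Real.goldenRatio_ne_zero
    have key : ∀ i : Fin 3, (rot135 3)⁻¹ * s i * rot135 3 =
        wordProd ((rot135Word 3).reverse ++ i :: rot135Word 3) := by
      intro i
      rw [wordProd_append, wordProd_cons, wordProd_reverse, wordProd_rot135Word, mul_assoc]
    fin_cases i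
    · apply Subgroup.subset_closure
      left
      rw [key, ← wordProd_singleton]
      exact isH_three.ext (by decide +kernel)
    · exact absurd hi hne
    · apply Subgroup.subset_closure
      right
      rw [Set.mem_singleton_iff, key, ← wordProd_r5Word]
      exact isH_three.ext (by decide +kernel)
  · rw [Subgroup.closure_le]
    rintro _ (rfl | rfl)
    · exact isH_three.s_two_mem_fixer
    · exact r5_three_mem_fixer

theorem card_closure_three : Nat.card (Subgroup.closure {s 2, r5 3}) = 4 := by
  have h1 : (1 : W 3) = wordProd [] := rfl
  rw [← wordProd_r5Word, ← wordProd_singleton]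
  apply card_closure_pair
  · rw [← wordProd_append, h1]; exact isH_three.ext (by decide +kernel)
  · rw [← wordProd_append, h1]; exact isH_three.ext (by decide +kernel)
  · rw [← wordProd_append, ← wordProd_append]; exact isH_three.ext (by decide +kernel)
  · exact isH_three.wordProd_ne (x := (2, false)) (l' := []) (by decide) (by decide +kernel)
  · exact isH_three.wordProd_ne (x := (14, false)) (l' := []) (by decide) (by decide +kernel)
  · exact isH_three.wordProd_ne (x := (2, false)) (by decide) (by decide +kernel)

theorem card_W_three : Nat.card (W 3) = 120 := by
  rw [isH_three.card_W IsH.transitiveCheck_three, fixer_three, card_closure_three]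
  rfl

end three

/-! ### Type H₃: the frame stabilizer and the normal forms -/

section three

theorem frame_three :
    ({simpleRoot 0, simpleRoot 2, beta5 3} : Set (V 3)) = frame 3 [0, 2, 14] := by
  have h0 := isH_three.table.simple 0
  have h2 := isH_three.table.simple 2
  change posRoot 3 0 = _ at h0
  change posRoot 3 2 = _ at h2
  rw [← h0, ← h2, beta5_three]
  ext v
  simp only [frame, Set.mem_insert_iff, Set.mem_singleton_iff, Set.mem_image, Set.mem_ofPred_eq,
    List.mem_cons, List.not_mem_nil, or_false, exists_eq_or_imp, exists_eq_left]
  simp only [eq_comm]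

/-- Generators of the stabilizer of `{β₁, β₃, β₅}`. -/
def frameWordsThree : List (List (Fin 3)) := [[0], [2], rot135Word 3]

noncomputable def frameGroupThree : Subgroup (W 3) :=
  Subgroup.closure {w | ∃ l ∈ frameWordsThree, wordProd l = w}

theorem frameGroupThree_le {K : Subgroup (W 3)} (h0 : s 0 ∈ K) (h2 : s 2 ∈ K)
    (hr : rot135 3 ∈ K) : frameGroupThree ≤ K := by
  rw [frameGroupThree, Subgroup.closure_le]
  rintro _ ⟨l, hl, rfl⟩
  simp only [frameWordsThree, List.mem_cons, List.not_mem_nil, or_false] at hl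
  rcases hl with rfl | rfl | rfl
  · rwa [wordProd_singleton]
  · rwa [wordProd_singleton]
  · rwa [wordProd_rot135Word]

theorem frameGroupThree_le_fixerEE : frameGroupThree ≤ fixerEE 3 :=
  frameGroupThree_le (s_zero_mem_fixerEE isH_three.start) (s_two_mem_fixerEE isH_three.start)
    (rot135_mem_fixerEE isH_three.start)

theorem frameGroupThree_le_rootStabilizer :
    frameGroupThree ≤ rootStabilizer (frame 3 [0, 2, 14]) := by
  rw [frameGroupThree, Subgroup.closure_le]
  rintro _ ⟨l, hl, rfl⟩
  apply isH_three.wordProd_mem_rootStabilizer (by decide)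
  revert l
  decide +kernel

theorem fixer_le_frameGroupThree : fixer (simpleRoot 0 : V 3) ≤ frameGroupThree := by
  have mem : ∀ l ∈ frameWordsThree, wordProd l ∈ frameGroupThree := fun l hl =>
    Subgroup.subset_closure ⟨l, hl, rfl⟩
  have h0 := mem [0] (by simp [frameWordsThree])
  have h2 := mem [2] (by simp [frameWordsThree])
  have hr := mem (rot135Word 3) (by simp [frameWordsThree])
  rw [wordProd_singleton] at h0 h2
  rw [wordProd_rot135Word] at hr
  rw [fixer_three, Subgroup.closure_le]
  rintro _ (rfl | rfl)
  · exact h2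
  · exact mul_mem (mul_mem hr h0) (inv_mem hr)

theorem exists_frameGroupThree {x : ℕ × Bool} (hx : x.1 ∈ [0, 2, 14]) :
    ∃ w ∈ frameGroupThree, geom 3 w (simpleRoot 0) = root 3 x := by
  have hstart : ∀ x ∈ [((0, false) : ℕ × Bool)], x.1 < numRoots 3 ∧
      ∃ w ∈ frameGroupThree, geom 3 w (simpleRoot 0) = root 3 x := by
    simpa using ⟨by decide, 1, one_mem _, by simpa using isH_three.root_zero.symm⟩
  have key := forall_mem_explore
    (P := fun x : ℕ × Bool => x.1 < numRoots 3 ∧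
      ∃ w ∈ frameGroupThree, geom 3 w (simpleRoot 0) = root 3 x)
    (gens := frameWordsThree.map wordAct) (by
      intro g hg x hx
      obtain ⟨l, hl, rfl⟩ := List.mem_map.1 hg
      obtain ⟨hx, w, hw, hwx⟩ := hx
      refine ⟨isH_three.table.wordAct_lt l hx, wordProd l * w,
        mul_mem (Subgroup.subset_closure ⟨l, hl, rfl⟩) hw, ?_⟩
      rw [geom_mul_apply, hwx, isH_three.table.geom_wordProd_root l hx]) 10 _ _ hstart hstart
  have hmem : ∀ n ∈ [0, 2, 14], ∀ b : Bool, (n, b) ∈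
      explore (frameWordsThree.map wordAct) 10 [((0, false) : ℕ × Bool)] [(0, false)] := by
    decide +kernel
  exact (key _ (hmem x.1 hx x.2)).2

/-- The generated group is transitive on the six signed roots of the frame and contains the full
stabilizer of β₁. -/
theorem rootStabilizer_le_frameGroupThree :
    rootStabilizer (frame 3 [0, 2, 14]) ≤ frameGroupThree := by
  intro w hw
  obtain ⟨x, hx, hwx⟩ := geom_mem_frame_union hw (n := 0) (by simp)
  obtain ⟨u, hu, hux⟩ := exists_frameGroupThree hx
  rw [← hwx, ← isH_three.root_zero] at hux
  have : u⁻¹ * w ∈ frameGroupThree := by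
    apply fixer_le_frameGroupThree
    rw [← geom_eq_geom_iff, ← isH_three.root_zero]
    exact hux
  have := mul_mem hu this
  rwa [mul_inv_cancel_left] at this

theorem card_rootStabilizer_frame_three :
    Nat.card (rootStabilizer (frame 3 [0, 2, 14])) = 24 := by
  rw [card_eq_ncard_image_mul (fixer_le_frameGroupThree.trans frameGroupThree_le_rootStabilizer)
    (fun w => geom 3 w (simpleRoot 0)) fun g g' => geom_eq_geom_iff g g' _]
  have himg : (fun w => geom 3 w (simpleRoot 0)) '' (rootStabilizer (frame 3 [0, 2, 14]) : Set (W 3))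
      = root 3 '' ((([0, 2, 14] : List ℕ).toFinset ×ˢ (Finset.univ : Finset Bool) :
        Finset (ℕ × Bool)) : Set (ℕ × Bool)) := by
    ext v
    constructor
    · rintro ⟨w, hw, rfl⟩
      obtain ⟨x, hx, hwx⟩ := geom_mem_frame_union hw (n := 0) (by simp)
      exact ⟨x, by simpa using hx, by
        change _ = geom 3 w (simpleRoot 0)
        rw [← isH_three.root_zero]; exact hwx.symm⟩
    · rintro ⟨x, hx, rfl⟩
      obtain ⟨u, hu, hux⟩ := exists_frameGroupThree (x := x) (by simpa using hx)
      exact ⟨u, frameGroupThree_le_rootStabilizer hu, hux⟩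
  rw [himg, Set.InjOn.ncard_image, Set.ncard_coe_finset, fixer_three, card_closure_three]
  · rfl
  · refine (root_injOn isH_three.nodup).mono ?_
    rintro ⟨n, b⟩ hx
    have : n = 0 ∨ n = 2 ∨ n = 14 := by simpa using hx
    rcases this with rfl | rfl | rfl <;> simp [numRoots]

theorem fixer_three_le_centralizerE : fixer (simpleRoot 0 : V 3) ≤ centralizerE 3 := by
  rw [fixer_three, Subgroup.closure_le]
  rintro _ (rfl | rfl)
  · exact s_mem_centralizerE isH_three.start.noBond
  · exact r5_mem_centralizerE isH_three.start

theorem e_one_conj {k : ℕ} [NeZero k] :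
    (e 1 : Br k) = toBr k (rot12 k)⁻¹ * e 0 * toBr k (rot12 k)⁻¹⁻¹ := by
  rw [inv_inv, mul_assoc, ← rot12_mul_e, ← mul_assoc, toBr_inv_mul, one_mul]

theorem e_two_conj {k : ℕ} [NeZero k] (H : StartsWithH3 k) :
    (e 2 : Br k) = toBr k (rot135 k)⁻¹ * e 0 * toBr k (rot135 k)⁻¹⁻¹ := by
  rw [inv_inv, mul_assoc, ← rot135_mul_e H, ← mul_assoc, toBr_inv_mul, one_mul]

theorem isReduced_three {a : Br 3} (ha : a ∈ BrM 3) : IsReduced a := by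
  have hcol := isH_three.collapses fixer_three_le_centralizerE orbitCheck_three
  refine isReduced_of_mem ?_ (fun w => (hcol w).imp_right And.left) ?_ ha
  · intro i
    fin_cases i
    · exact ⟨1, by simp⟩
    · exact ⟨_, e_one_conj⟩
    · exact ⟨_, e_two_conj isH_three.start⟩
  · intro w
    by_contra! hno
    have hrot := rot135_mem_fixerEE isH_three.start
    -- If no κ helps, w⁻¹β₁ is orthogonal to κβ₁ for every absorbed κ. The choices 1, `rot135` and
    -- its inverse give β₁, β₅, β₃, which span the space.
    have h : ∀ κ ∈ fixerEE 3,
        ip 3 (geom 3 w⁻¹ (simpleRoot 0)) (geom 3 κ (simpleRoot 0)) = 0 := by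
      intro κ hκ
      have := ((hcol (w * κ)).resolve_left (hno κ hκ)).2
      rwa [geom_mul_apply, ip_comm, ← ip_geom w⁻¹, geom_inv_apply] at this
    have h0 := h 1 (one_mem _)
    have h5 := h _ hrot
    have h2 := h _ (inv_mem hrot)
    rw [map_one, Module.End.one_apply] at h0
    rw [rot135_three_zero] at h5
    rw [rot135_inv_three_zero] at h2
    refine IsH.ip_self_ne_zero w⁻¹ fun i => ?_
    fin_cases i
    · exact h0
    · exact IsH.ip_one_eq_zero h0 h2 h5
    · exact h2

theorem normalForms_three (D₁ C₁ D₂ : Set (W 3))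
    (hD₁ : IsLeftTransversal D₁ (rootStabilizer {simpleRoot 0}) ⊤)
    (hC₁ : C₁ = Subgroup.closure {s 2, r5 3})
    (hD₂ : IsLeftTransversal D₂ (rootStabilizer {simpleRoot 0, simpleRoot 2, beta5 3}) ⊤) :
    (∀ a ∈ BrM 3, ∃ n : ℤ, ∃ f ∈ normalForms D₁ C₁ D₂, a = deltaPow n • f.eval) ∧
      (normalForms D₁ C₁ D₂).ncard = 1045 := by
  rw [frame_three] at hD₂
  constructor
  · refine exists_normalForm (C := fixer (simpleRoot 0)) (fun a => isReduced_three) hD₁ hD₂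
      (fun n hn => mem_or_mul_mem le_rfl hn) fixer_three_le_centralizerE (fun c hc => ?_)
      (rootStabilizer_le_frameGroupThree.trans frameGroupThree_le_fixerEE)
    refine ⟨c, ?_, hc, rfl⟩
    rw [hC₁, ← fixer_three]; exact hc
  · have hfin : Finite (W 3) := Nat.finite_of_card_ne_zero (by rw [card_W_three]; norm_num)
    have h1 := hD₁.ncard_mul le_top
    have h2 := hD₂.ncard_mul le_top
    rw [Subgroup.card_top, card_W_three, card_rootStabilizer_singleton, fixer_three,
      card_closure_three] at h1
    rw [Subgroup.card_top, card_W_three, card_rootStabilizer_frame_three] at h2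
    -- The indices are 120 / 8 and 120 / 24.
    have e1 : D₁.ncard = 15 := by omega
    have e2 : D₂.ncard = 5 := by omega
    have e3 : C₁.ncard = 4 := by
      rw [hC₁, ← Nat.card_coe_set_eq]; exact card_closure_three
    rw [ncard_normalForms, card_W_three, e1, e2, e3]
    rfl

end three

/-! ### Type H₄: the stabilizer of β₁ and the group order -/

section four

theorem beta5_four : beta5 4 = posRoot 4 14 := by
  ext i
  fin_cases i <;> simp [beta5, posRoot, coord, rootTable, toReal, simpleRoot, add_comm]

theorem beta7_eq : beta7 = posRoot 4 59 := by
  have h := Real.goldenRatio_sq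
  ext i
  simp only [beta7, beta5, posRoot, toReal]
  generalize Real.goldenRatio = φ at *
  fin_cases i <;> simp [coord, rootTable, simpleRoot]
  · linear_combination (φ ^ 2 + φ + 2) * h
  · linear_combination 2 * (φ + 1) * h
  · linear_combination (φ + 1) * h

theorem ip_posRoot_59 (i : Fin 4) :
    ip 4 (posRoot 4 59) (simpleRoot i) = ![0, 0, 0, Real.goldenRatio - 1] i := by
  have h := Real.goldenRatio_sq
  simp only [ip_eq, gram_four, posRoot, toReal]
  generalize Real.goldenRatio = φ at *
  fin_cases i <;> simp [Fin.sum_univ_four, coord, rootTable, simpleRoot] <;>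
    first | ring1 | linear_combination (-4) * h | linear_combination (-3) * h

theorem ip_posRoot_14 (i : Fin 4) :
    ip 4 (posRoot 4 14) (simpleRoot i) =
      ![0, Real.goldenRatio - 1, 0, -Real.goldenRatio] i := by
  have h := Real.goldenRatio_sq
  simp only [ip_eq, gram_four, posRoot, toReal]
  generalize Real.goldenRatio = φ at *
  fin_cases i <;> simp [Fin.sum_univ_four, coord, rootTable, simpleRoot] <;>
    first | ring1 | linear_combination (-2) * h | linear_combination (-1) * h

theorem rot135_four_zero : geom 4 (rot135 4) (simpleRoot 0) = beta5 4 := by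
  rw [← wordProd_rot135Word, isH_four.geom_wordProd_simpleRoot_zero, beta5_four,
    show wordAct (rot135Word 4) (0, false) = (14, false) by decide +kernel]
  rfl

theorem rot135_inv_four_zero : geom 4 (rot135 4)⁻¹ (simpleRoot 0) = simpleRoot 2 := by
  rw [← wordProd_rot135Word, ← wordProd_reverse, isH_four.geom_wordProd_simpleRoot_zero,
    ← isH_four.table.root_simple,
    show wordAct (rot135Word 4).reverse (0, false) = (simpleIdx (2 : Fin 4), false) by
      decide +kernel]

theorem conj_eq_wordProd (l : List (Fin 4)) (i : Fin 4) :
    (wordProd l)⁻¹ * s i * wordProd l = wordProd (l.reverse ++ i :: l) := by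
  rw [wordProd_append, wordProd_cons, wordProd_reverse, mul_assoc]

/-- A word that maps `β₁`, `β₅`, `β₄`, `β₃` to `β₇`, `β₁`, `β₂`, `β₃`. -/
def topWord : List (Fin 4) := [3, 2, 1, 0, 1, 2, 3, 0, 1, 2, 0, 1, 0, 1, 2, 3, 1, 0, 1, 2, 0, 1]

theorem topWord_conj_zero : (wordProd topWord)⁻¹ * s 0 * wordProd topWord = r5 4 := by
  rw [conj_eq_wordProd, ← wordProd_r5Word]
  exact isH_four.ext (by decide +kernel)

theorem topWord_conj_one : (wordProd topWord)⁻¹ * s 1 * wordProd topWord = s 3 := by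
  rw [conj_eq_wordProd, ← wordProd_singleton]
  exact isH_four.ext (by decide +kernel)

theorem topWord_conj_two : (wordProd topWord)⁻¹ * s 2 * wordProd topWord = s 2 := by
  rw [conj_eq_wordProd, ← wordProd_singleton]
  exact isH_four.ext (by decide +kernel)

theorem topWord_zero : geom 4 (wordProd topWord) (simpleRoot 0) = posRoot 4 59 := by
  rw [isH_four.geom_wordProd_simpleRoot_zero,
    show wordAct topWord (0, false) = (59, false) by decide +kernel]
  rfl

/-- `topWord` carries β₁ to the dominant root β₇, which is orthogonal to exactly the first three
simple roots. The stabilizer is thus conjugate to the parabolic subgroup of type H₃, with r₁, r₂, r₃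
corresponding to r₅, r₄, r₃. -/
theorem fixer_four : fixer (simpleRoot 0 : V 4) = Subgroup.closure {s 2, s 3, r5 4} := by
  have hφ := goldenRatio_bounds
  refine le_antisymm (finiteRoots_four.fixer_le (wordProd topWord) _ ?_ ?_) ?_
  · intro i
    rw [topWord_zero, ip_posRoot_59]
    fin_cases i
    · exact le_rfl
    · exact le_rfl
    · exact le_rfl
    · change 0 ≤ Real.goldenRatio - 1
      linarith [hφ.1]
  · intro i hi
    rw [topWord_zero, ip_posRoot_59] at hi
    apply Subgroup.subset_closure
    fin_cases i
    · right; right; exact topWord_conj_zero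
    · right; left; exact topWord_conj_one
    · left; exact topWord_conj_two
    · change Real.goldenRatio - 1 = 0 at hi
      linarith [hφ.1]
  · rw [Subgroup.closure_le]
    rintro _ (rfl | rfl | rfl)
    · exact isH_four.s_two_mem_fixer
    · have h : gram 4 0 3 = 0 := by rw [gram_four]; rfl
      rw [SetLike.mem_coe, mem_fixer, geom_s, reflection_apply, ip_simple, h, zero_smul, sub_zero]
    · rw [SetLike.mem_coe, mem_fixer, ← wordProd_r5Word, isH_four.geom_wordProd_simpleRoot_zero,
        show wordAct (r5Word 4) (0, false) = (0, false) by decide +kernel, isH_four.root_zero]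

/-! The parabolic subgroup of type `H₃`. -/

theorem hMatrix_castSucc (i j : Fin 3) :
    hMatrix 4 i.castSucc j.castSucc = hMatrix 3 i j := by
  fin_cases i <;> fin_cases j <;> rfl

theorem parabolic_isLiftable :
    (hMatrix 3).IsLiftable (fun i : Fin 3 => (s i.castSucc : W 4)) := by
  intro i j
  have h := (hMatrix 4).toCoxeterSystem.simple_mul_simple_pow i.castSucc j.castSucc
  have hM : (hMatrix 4).M i.castSucc j.castSucc = (hMatrix 3).M i j := hMatrix_castSucc i j
  rw [hM] at h
  exact h

noncomputable def parabolic : W 3 →* W 4 :=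
  (hMatrix 3).toCoxeterSystem.lift ⟨_, parabolic_isLiftable⟩

theorem parabolic_s (i : Fin 3) : parabolic (s i) = s i.castSucc :=
  (hMatrix 3).toCoxeterSystem.lift_apply_simple parabolic_isLiftable i

noncomputable def extendZero : V 3 →ₗ[ℝ] V 4 :=
  Fintype.linearCombination ℝ fun i : Fin 3 => (simpleRoot i.castSucc : V 4)

theorem extendZero_apply_castSucc (v : V 3) (i : Fin 3) : extendZero v i.castSucc = v i := by
  simp [extendZero, Fintype.linearCombination_apply, simpleRoot, Pi.single_apply]

theorem extendZero_injective : Function.Injective extendZero := fun u v h =>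
  funext fun i => by rw [← extendZero_apply_castSucc u, h, extendZero_apply_castSucc]

theorem extendZero_simpleRoot (i : Fin 3) : extendZero (simpleRoot i) = simpleRoot i.castSucc := by
  simp [extendZero, simpleRoot]

theorem geom_parabolic (w : W 3) (v : V 3) :
    geom 4 (parabolic w) (extendZero v) = extendZero (geom 3 w v) := by
  induction w using (hMatrix 3).toCoxeterSystem.simple_induction generalizing v with
  | simple i =>
    change geom 4 (parabolic (s i)) _ = extendZero (geom 3 (s i) v)
    rw [parabolic_s, geom_s, geom_s, reflection_apply, reflection_apply, map_sub, map_smul,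
      extendZero_simpleRoot]
    congr 2
    have h : (ip 4).flip (simpleRoot i.castSucc) ∘ₗ extendZero = (ip 3).flip (simpleRoot i) := by
      refine LinearMap.pi_ext' fun j => LinearMap.ext_ring ?_
      change ip 4 (extendZero (simpleRoot j)) _ = ip 3 (simpleRoot j) _
      rw [extendZero_simpleRoot, ip_simple, ip_simple]
      simp only [gram, hMatrix_castSucc]
    exact LinearMap.congr_fun h v
  | one => simp
  | mul a b ha hb => rw [map_mul, geom_mul_apply, hb, ha, geom_mul_apply]

theorem parabolic_injective : Function.Injective parabolic := by
  intro a b h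
  refine finiteRoots_three.faithful (LinearMap.ext fun v => extendZero_injective ?_)
  rw [← geom_parabolic, h, geom_parabolic]

/-- Conjugation by `topWord` identifies this group with the image of W(H₃) in W(H₄). That map is
injective because the reflection action of W(H₃) is faithful and embeds equivariantly in that of
W(H₄). -/
theorem card_closure_four : Nat.card (Subgroup.closure {s 2, s 3, r5 4}) = 120 := by
  let ψ : W 3 →* W 4 := (MulAut.conj (wordProd topWord)⁻¹).toMonoidHom.comp parabolic
  have hψ : Function.Injective ψ := (MulAut.conj _).injective.comp parabolic_injective
  have hψs : ∀ i, ψ (s i) = (wordProd topWord)⁻¹ * s i.castSucc * wordProd topWord := by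
    intro i
    simp [ψ, parabolic_s]
  have hr : ψ.range = Subgroup.closure {s 2, s 3, r5 4} := by
    rw [MonoidHom.range_eq_map, ← closure_range_s, MonoidHom.map_closure]
    congr 1
    ext w
    constructor
    · rintro ⟨_, ⟨i, rfl⟩, rfl⟩
      rw [hψs]
      fin_cases i
      · right; right; exact topWord_conj_zero
      · right; left; exact topWord_conj_one
      · left; exact topWord_conj_two
    · rintro (rfl | rfl | rfl)
      · exact ⟨_, ⟨2, rfl⟩, (hψs 2).trans topWord_conj_two⟩
      · exact ⟨_, ⟨1, rfl⟩, (hψs 1).trans topWord_conj_one⟩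
      · exact ⟨_, ⟨0, rfl⟩, (hψs 0).trans topWord_conj_zero⟩
  rw [← hr, ← card_W_three]
  exact (Nat.card_congr (MonoidHom.ofInjective hψ).toEquiv).symm

theorem card_W_four : Nat.card (W 4) = 14400 := by
  rw [isH_four.card_W IsH.transitiveCheck_four, fixer_four, card_closure_four]
  rfl

theorem fixer_four_le_centralizerE : fixer (simpleRoot 0 : V 4) ≤ centralizerE 4 := by
  rw [fixer_four, Subgroup.closure_le]
  rintro _ (rfl | rfl | rfl)
  · exact s_mem_centralizerE isH_four.start.noBond
  · exact s_mem_centralizerE (by decide)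
  · exact r5_mem_centralizerE isH_four.start

theorem e_three_conj : (e 3 : Br 4) = toBr 4 (s 2 * s 3 * (rot135 4)⁻¹) * e 0 *
    toBr 4 (s 2 * s 3 * (rot135 4)⁻¹)⁻¹ := by
  have h : (r 2 * e 3 * r 2 : Br 4) = r 3 * e 2 * r 3 := r_e_r (by decide)
  calc (e 3 : Br 4) = r 2 * (r 2 * e 3 * r 2) * r 2 := by
        simp only [mul_assoc, r_mul_r, r_mul_r_mul, mul_one]
    _ = _ := by
        rw [h, e_two_conj isH_four.start]
        simp only [map_mul, mul_inv_rev, inv_inv, s_inv, toBr_s, mul_assoc]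

end four

/-! ### Type H₄: the frame stabilizer and the normal forms -/

section four

/-- The element `r₄r₅r₄r₅`, which maps `β₄` to `±β₅`. -/
def rot45 : W 4 := s 3 * r5 4 * s 3 * r5 4

/-- The element `r₄r₅r₄r₅r₃r₄`, which fixes `β₁` and permutes `β₃`, `β₅`, `β₇` up to sign. -/
def rot357 : W 4 := rot45 * (s 2 * s 3)

def rot45Word : List (Fin 4) := 3 :: r5Word 4 ++ 3 :: r5Word 4

theorem wordProd_rot45Word : wordProd rot45Word = rot45 := by
  simp only [rot45Word, rot45, wordProd_append, wordProd_cons, wordProd_r5Word, mul_assoc]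

def rot357Word : List (Fin 4) := rot45Word ++ [2, 3]

theorem wordProd_rot357Word : wordProd rot357Word = rot357 := by
  simp only [rot357Word, rot357, wordProd_append, wordProd_rot45Word, wordProd_cons,
    wordProd_nil, mul_one]

/-- The element `e₅`, conjugate to `e₁`. -/
noncomputable def e5 : Br 4 := toBr 4 (rot135 4) * e 0 * toBr 4 (rot135 4)⁻¹

/-- Writing e₄ and e₅ as conjugates of e₁ turns the claim into a statement about one group element,
which centralizes e₁ because it fixes β₁. -/
theorem rot45_mul_e : toBr 4 rot45 * e 3 = e5 * toBr 4 rot45 := by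
  set h : W 4 := s 2 * s 3 * (rot135 4)⁻¹ with hh
  have hc : (rot135 4)⁻¹ * rot45 * h ∈ centralizerE 4 := by
    apply fixer_four_le_centralizerE
    have : (rot135 4)⁻¹ * rot45 * h = wordProd ((rot135Word 4).reverse ++ rot45Word ++ 2 :: 3 ::
        (rot135Word 4).reverse) := by
      simp only [hh, wordProd_append, wordProd_cons, wordProd_reverse, wordProd_rot135Word,
        wordProd_rot45Word, mul_assoc]
    rw [mem_fixer, this, isH_four.geom_wordProd_simpleRoot_zero, ← isH_four.root_zero,
      show wordAct ((rot135Word 4).reverse ++ rot45Word ++ 2 :: 3 :: (rot135Word 4).reverse)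
        (0, false) = (0, false) by decide +kernel]
  have hc' : toBr 4 ((rot135 4)⁻¹ * rot45 * h) * e 0 =
    e 0 * toBr 4 ((rot135 4)⁻¹ * rot45 * h) := hc
  have h1 : toBr 4 rot45 * toBr 4 h =
      toBr 4 (rot135 4) * toBr 4 ((rot135 4)⁻¹ * rot45 * h) := by
    rw [← map_mul, ← map_mul]; congr 1; group
  rw [e_three_conj, ← hh, ← mul_assoc, ← mul_assoc, h1, mul_assoc (toBr 4 (rot135 4)), hc']
  simp only [e5, map_mul, mul_assoc, toBr_mul_inv, mul_one]

theorem e_mul_rot45_inv : e 3 * toBr 4 rot45⁻¹ = toBr 4 rot45⁻¹ * e5 := by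
  calc e 3 * toBr 4 rot45⁻¹
      = toBr 4 rot45⁻¹ * (toBr 4 rot45 * e 3) * toBr 4 rot45⁻¹ := by
        simp only [← mul_assoc, toBr_inv_mul, one_mul]
    _ = _ := by rw [rot45_mul_e]; simp only [mul_assoc, toBr_mul_inv, mul_one]

/-- The analogue of e₁r₂r₁r₂e₁ = e₁ in the H₃ system r₅, r₄, r₃. Conjugation by `rot135` turns
r₄r₅r₄ into r₂r₁r₂ conjugated by r₄r₃, which commutes with e₁. -/
theorem e5_mul_e5 : e5 * toBr 4 (s 3 * r5 4 * s 3) * e5 = e5 := by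
  have h1 : (rot135 4)⁻¹ * (s 3 * r5 4 * s 3) * rot135 4 =
      s 3 * s 2 * (s 1 * s 0 * s 1) * (s 3 * s 2)⁻¹ := by
    have hl : (rot135 4)⁻¹ * (s 3 * r5 4 * s 3) * rot135 4 =
        wordProd ((rot135Word 4).reverse ++ (3 :: r5Word 4 ++ 3 :: rot135Word 4)) := by
      simp only [wordProd_append, wordProd_cons, wordProd_reverse, wordProd_rot135Word,
        wordProd_r5Word, mul_assoc]
    have hr : (s 3 : W 4) * s 2 * (s 1 * s 0 * s 1) * (s 3 * s 2)⁻¹ =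
        wordProd [3, 2, 1, 0, 1, 2, 3] := by
      simp only [wordProd_cons, wordProd_nil, mul_one, mul_inv_rev, s_inv, mul_assoc]
    rw [hl, hr]
    exact isH_four.ext (by decide +kernel)
  have hn : (s 3 * s 2 : W 4) ∈ centralizerE 4 :=
    mul_mem (s_mem_centralizerE (by decide)) (s_mem_centralizerE (by decide))
  have h2 : e 0 * toBr 4 (s 1 * s 0 * s 1) * e 0 = (e 0 : Br 4) := by
    simpa only [map_mul, toBr_s, mul_assoc] using e_r_r_r_e (k := 4)
  have h3 : e 0 * toBr 4 ((rot135 4)⁻¹ * (s 3 * r5 4 * s 3) * rot135 4) * e 0 = (e 0 : Br 4) := by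
    have hn' : toBr 4 (s 3 * s 2) * e 0 = e 0 * toBr 4 (s 3 * s 2) := hn
    rw [h1, e_toBr_mul_e' (inv_mem hn), e_toBr_mul_e hn, h2, hn', mul_assoc, toBr_mul_inv, mul_one]
  calc e5 * toBr 4 (s 3 * r5 4 * s 3) * e5
      = toBr 4 (rot135 4) * (e 0 * toBr 4 ((rot135 4)⁻¹ * (s 3 * r5 4 * s 3) * rot135 4) * e 0) *
          toBr 4 (rot135 4)⁻¹ := by
        simp only [e5, map_mul, mul_assoc]
    _ = e5 := by rw [h3, e5]

/-- Since e₁e₃ absorbs `rot135`, e₅ acts on it as e₁ does. -/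
theorem e5_mul_ee : e5 * (e 0 * e 2) = deltaPow 2 • (e 0 * e 2) := by
  have h := (inv_mem (rot135_mem_fixerEE isH_four.start)).1
  have h' := (rot135_mem_fixerEE isH_four.start).1
  rw [e5, mul_assoc, h, mul_assoc, ← mul_assoc (e 0), e_mul_e, smul_mul_assoc, mul_smul_comm, h']

theorem ee_mul_e5 : e 0 * e 2 * e5 = deltaPow 2 • (e 0 * e 2) := by
  have h := (inv_mem (rot135_mem_fixerEE isH_four.start)).2
  have h' := (rot135_mem_fixerEE isH_four.start).2
  rw [e5, ← mul_assoc, ← mul_assoc, h', e_e_comm isH_four.start.noBond, mul_assoc (e 2), e_mul_e,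
    mul_smul_comm, smul_mul_assoc, ← e_e_comm isH_four.start.noBond, h]

theorem eq_deltaPow_smul {a b : Br 4} (h : a = deltaPow 2 • b) : b = deltaPow (-2) • a := by
  rw [h, deltaPow_smul_smul]; exact (deltaPow_zero_smul b).symm

/-- The computation for `rot135` is repeated with r₅, r₄, r₃ in the roles of r₁, r₂, r₃. Here e₅ is
not a factor of e₁e₃, but e₁e₃ = δ⁻² e₅ e₁e₃ supplies it; this uses that δ is invertible. -/
theorem rot357_mem_fixerEE : rot357 ∈ fixerEE 4 := by
  have h02 : (e 0 * e 2 : Br 4) = e 2 * e 0 := e_e_comm isH_four.start.noBond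
  have hb : hMatrix 4 3 2 = 3 := by decide
  have hr5 := r5_mem_fixerEE isH_four.start
  have h1 := eq_deltaPow_smul e5_mul_ee
  have h2 := eq_deltaPow_smul ee_mul_e5
  have left : toBr 4 rot357 * (e 0 * e 2) = e 0 * e 2 := by
    have step : e5 * (toBr 4 (s 3 * r5 4 * s 3) * (e 0 * e 2)) = e 0 * e 2 := by
      conv_lhs => rw [h1, mul_smul_comm, mul_smul_comm, ← mul_assoc, ← mul_assoc, e5_mul_e5]
      exact h1.symm
    calc toBr 4 rot357 * (e 0 * e 2)
        = toBr 4 rot45 * (r 2 * r 3 * e 2) * e 0 := by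
          rw [h02]; simp only [rot357, map_mul, toBr_s, mul_assoc]
      _ = e5 * (toBr 4 rot45 * (e 0 * e 2)) := by
          rw [r_r_e hb, ← mul_assoc, rot45_mul_e, h02]; simp only [mul_assoc]
      _ = e5 * (toBr 4 (s 3 * r5 4 * s 3) * (toBr 4 (r5 4) * (e 0 * e 2))) := by
          simp only [rot45, map_mul, mul_assoc]
      _ = _ := by rw [hr5.1, step]
  have right : e 0 * e 2 * toBr 4 rot357⁻¹ = e 0 * e 2 := by
    have step : e 0 * e 2 * toBr 4 (s 3 * r5 4 * s 3) * e5 = e 0 * e 2 := by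
      conv_lhs => rw [h2, smul_mul_assoc, smul_mul_assoc, mul_assoc (e 0 * e 2),
        mul_assoc (e 0 * e 2), e5_mul_e5]
      exact h2.symm
    have hinv : rot45⁻¹ = r5 4 * (s 3 * r5 4 * s 3) := by
      have h5 : (r5 4)⁻¹ = r5 4 := by
        rw [r5_eq]; simp only [mul_inv_rev, inv_inv, s_inv, mul_assoc]
      simp only [rot45, mul_inv_rev, s_inv, h5, mul_assoc]
    calc e 0 * e 2 * toBr 4 rot357⁻¹
        = e 0 * (e 2 * r 3 * r 2) * toBr 4 rot45⁻¹ := by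
          simp only [rot357, mul_inv_rev, s_inv, map_mul, toBr_s, mul_assoc]
      _ = e 0 * e 2 * (e 3 * toBr 4 rot45⁻¹) := by
          rw [e_r_r hb]; simp only [mul_assoc]
      _ = e 0 * e 2 * toBr 4 (r5 4) * toBr 4 (s 3 * r5 4 * s 3) * e5 := by
          rw [e_mul_rot45_inv, hinv]; simp only [map_mul, mul_assoc]
      _ = _ := by rw [hr5.2, step]
  refine ⟨left, ?_⟩
  conv_lhs => rw [← right, mul_assoc, toBr_inv_mul, mul_one]

/-- The reflection in `β₇`. -/
def r7 : W 4 := rot357 * r5 4 * rot357⁻¹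

def r7Word : List (Fin 4) := rot357Word ++ r5Word 4 ++ rot357Word.reverse

theorem wordProd_r7Word : wordProd r7Word = r7 := by
  simp only [r7Word, r7, wordProd_append, wordProd_reverse, wordProd_rot357Word, wordProd_r5Word]

theorem frame_four :
    ({simpleRoot 0, simpleRoot 2, beta5 4, beta7} : Set (V 4)) = frame 4 [0, 2, 14, 59] := by
  have h0 := isH_four.table.simple 0
  have h2 := isH_four.table.simple 2
  change posRoot 4 0 = _ at h0
  change posRoot 4 2 = _ at h2
  rw [← h0, ← h2, beta5_four, beta7_eq]
  ext v
  simp only [frame, Set.mem_insert_iff, Set.mem_singleton_iff, Set.mem_image, Set.mem_ofPred_eq,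
    List.mem_cons, List.not_mem_nil, or_false, exists_eq_or_imp, exists_eq_left]
  simp only [eq_comm]

/-- Generators of the stabilizer of `{β₁, β₃, β₅, β₇}`. -/
def frameWordsFour : List (List (Fin 4)) := [[0], [2], rot135Word 4, rot357Word]

noncomputable def frameGroupFour : Subgroup (W 4) :=
  Subgroup.closure {w | ∃ l ∈ frameWordsFour, wordProd l = w}

theorem frameGroupFour_le_fixerEE : frameGroupFour ≤ fixerEE 4 := by
  rw [frameGroupFour, Subgroup.closure_le]
  rintro _ ⟨l, hl, rfl⟩
  simp only [frameWordsFour, List.mem_cons, List.not_mem_nil, or_false] at hl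
  rcases hl with rfl | rfl | rfl | rfl
  · rw [wordProd_singleton]; exact s_zero_mem_fixerEE isH_four.start
  · rw [wordProd_singleton]; exact s_two_mem_fixerEE isH_four.start
  · rw [wordProd_rot135Word]; exact rot135_mem_fixerEE isH_four.start
  · rw [wordProd_rot357Word]; exact rot357_mem_fixerEE

theorem frameGroupFour_le_rootStabilizer :
    frameGroupFour ≤ rootStabilizer (frame 4 [0, 2, 14, 59]) := by
  rw [frameGroupFour, Subgroup.closure_le]
  rintro _ ⟨l, hl, rfl⟩
  apply isH_four.wordProd_mem_rootStabilizer (by decide)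
  revert l
  decide +kernel

/-- The simultaneous stabilizer of `β₁` and `β₃`. -/
noncomputable def pairFixer : Subgroup (W 4) := fixer (simpleRoot 0) ⊓ fixer (simpleRoot 2)

/-- A word that maps `10 β₁ + β₃` to a dominant vector. -/
def pairWord : List (Fin 4) :=
  [1, 2, 3, 0, 1, 2, 0, 1, 0, 1, 2, 3, 1, 0, 1, 2, 0, 1, 0, 1, 2, 3, 1, 0, 1, 2, 0, 1]

theorem root_two_four : root 4 (2, false) = simpleRoot 2 := isH_four.table.root_simple 2

theorem geom_wordProd_simpleRoot_two (l : List (Fin 4)) :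
    geom 4 (wordProd l) (simpleRoot 2) = root 4 (wordAct l (2, false)) := by
  rw [← root_two_four]
  exact isH_four.table.geom_wordProd_root l (by decide)

/-- An element fixing β₁ and β₃ fixes 10β₁ + β₃, which `pairWord` carries to 10β₇ + β₅. The weight
10 makes this dominant: the product with β₄ is 9φ - 10 > 0, although (β₅, β₄) = -φ. It is orthogonal
to β₁ and β₃ only, which correspond to r₇ and r₅. -/
theorem pairFixer_eq : pairFixer = Subgroup.closure {r5 4, r7} := by
  have hφ := goldenRatio_bounds
  have hg : geom 4 (wordProd pairWord) ((10 : ℝ) • simpleRoot 0 + simpleRoot 2) =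
      (10 : ℝ) • posRoot 4 59 + posRoot 4 14 := by
    rw [map_add, map_smul, isH_four.geom_wordProd_simpleRoot_zero, geom_wordProd_simpleRoot_two,
      show wordAct pairWord (0, false) = (59, false) by decide +kernel,
      show wordAct pairWord (2, false) = (14, false) by decide +kernel]
    rfl
  have hip : ∀ i, ip 4 ((10 : ℝ) • posRoot 4 59 + posRoot 4 14) (simpleRoot i) =
      ![0, Real.goldenRatio - 1, 0, 9 * Real.goldenRatio - 10] i := by
    intro i
    rw [map_add, map_smul, LinearMap.add_apply, LinearMap.smul_apply, ip_posRoot_59, ip_posRoot_14]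
    generalize Real.goldenRatio = φ
    fin_cases i <;> simp
    ring
  refine le_antisymm ?_ ?_
  · have hle : pairFixer ≤ fixer ((10 : ℝ) • (simpleRoot 0 : V 4) + simpleRoot 2) := by
      rintro w ⟨h0, h2⟩
      rw [mem_fixer, map_add, map_smul, mem_fixer.1 h0, mem_fixer.1 h2]
    refine hle.trans (finiteRoots_four.fixer_le (wordProd pairWord) _ ?_ ?_)
    · intro i
      rw [hg, hip]
      fin_cases i
      · exact le_rfl
      · change 0 ≤ Real.goldenRatio - 1
        linarith [hφ.1]
      · exact le_rfl
      · change 0 ≤ 9 * Real.goldenRatio - 10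
        linarith [hφ.1]
    · intro i hi
      rw [hg, hip] at hi
      apply Subgroup.subset_closure
      fin_cases i
      · right
        rw [Set.mem_singleton_iff, conj_eq_wordProd, ← wordProd_r7Word]
        exact isH_four.ext (by decide +kernel)
      · change Real.goldenRatio - 1 = 0 at hi
        linarith [hφ.1]
      · left
        rw [conj_eq_wordProd, ← wordProd_r5Word]
        exact isH_four.ext (by decide +kernel)
      · change 9 * Real.goldenRatio - 10 = 0 at hi
        linarith [hφ.1]
  · have key : ∀ l : List (Fin 4), wordAct l (0, false) = (0, false) →
        wordAct l (2, false) = (2, false) → wordProd l ∈ pairFixer := by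
      intro l h0 h2
      refine ⟨mem_fixer.2 ?_, mem_fixer.2 ?_⟩
      · rw [isH_four.geom_wordProd_simpleRoot_zero, h0,
          isH_four.root_zero]
      · rw [geom_wordProd_simpleRoot_two, h2, root_two_four]
    rw [Subgroup.closure_le]
    rintro _ (rfl | rfl)
    · rw [← wordProd_r5Word]; exact key _ (by decide +kernel) (by decide +kernel)
    · rw [← wordProd_r7Word]; exact key _ (by decide +kernel) (by decide +kernel)

theorem card_pairFixer : Nat.card pairFixer = 4 := by
  have h1 : (1 : W 4) = wordProd [] := rfl
  rw [pairFixer_eq, ← wordProd_r5Word, ← wordProd_r7Word]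
  apply card_closure_pair
  · rw [← wordProd_append, h1]; exact isH_four.ext (by decide +kernel)
  · rw [← wordProd_append, h1]; exact isH_four.ext (by decide +kernel)
  · rw [← wordProd_append, ← wordProd_append]; exact isH_four.ext (by decide +kernel)
  · exact isH_four.wordProd_ne (x := (14, false)) (l' := []) (by decide) (by decide +kernel)
  · exact isH_four.wordProd_ne (x := (59, false)) (l' := []) (by decide) (by decide +kernel)
  · exact isH_four.wordProd_ne (x := (14, false)) (by decide) (by decide +kernel)

theorem pairFixer_le_frameGroupFour : pairFixer ≤ frameGroupFour := by
  have mem : ∀ l ∈ frameWordsFour, wordProd l ∈ frameGroupFour := fun l hl =>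
    Subgroup.subset_closure ⟨l, hl, rfl⟩
  have h0 := mem [0] (by simp [frameWordsFour])
  have hr := mem (rot135Word 4) (by simp [frameWordsFour])
  have ht := mem rot357Word (by simp [frameWordsFour])
  rw [wordProd_singleton] at h0
  rw [wordProd_rot135Word] at hr
  rw [wordProd_rot357Word] at ht
  have h5 : r5 4 ∈ frameGroupFour := mul_mem (mul_mem hr h0) (inv_mem hr)
  rw [pairFixer_eq, Subgroup.closure_le]
  rintro _ (rfl | rfl)
  · exact h5
  · exact mul_mem (mul_mem ht h5) (inv_mem ht)

/-- Pairs of distinct roots in the frame, up to sign. -/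
def framePairs : List ((ℕ × Bool) × (ℕ × Bool)) :=
  let L := [0, 2, 14, 59].flatMap fun n => [(n, false), (n, true)]
  (L.product L).filter fun p => p.1.1 != p.2.1

theorem exists_frameGroupFour {p : (ℕ × Bool) × (ℕ × Bool)} (hp : p ∈ framePairs) :
    ∃ w ∈ frameGroupFour, geom 4 w (simpleRoot 0) = root 4 p.1 ∧
      geom 4 w (simpleRoot 2) = root 4 p.2 := by
  let P : (ℕ × Bool) × (ℕ × Bool) → Prop := fun p => p.1.1 < numRoots 4 ∧ p.2.1 < numRoots 4 ∧
    ∃ w ∈ frameGroupFour, geom 4 w (simpleRoot 0) = root 4 p.1 ∧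
      geom 4 w (simpleRoot 2) = root 4 p.2
  have hstart : ∀ p ∈ [(((0, false), (2, false)) : (ℕ × Bool) × (ℕ × Bool))], P p := by
    intro p hp
    obtain rfl := List.mem_singleton.1 hp
    exact ⟨by decide, by decide, 1, one_mem _, by simpa using isH_four.root_zero.symm,
      by simpa using root_two_four.symm⟩
  have key := forall_mem_explore (P := P)
    (gens := frameWordsFour.map fun l => Prod.map (wordAct l) (wordAct l)) (by
      intro g hg x hx
      obtain ⟨l, hl, rfl⟩ := List.mem_map.1 hg
      obtain ⟨h1, h2, w, hw, hw1, hw2⟩ := hx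
      refine ⟨isH_four.table.wordAct_lt l h1, isH_four.table.wordAct_lt l h2, wordProd l * w,
        mul_mem (Subgroup.subset_closure ⟨l, hl, rfl⟩) hw, ?_, ?_⟩
      · rw [geom_mul_apply, hw1, isH_four.table.geom_wordProd_root l h1]; rfl
      · rw [geom_mul_apply, hw2, isH_four.table.geom_wordProd_root l h2]; rfl) 20 _ _ hstart hstart
  have hmem : ∀ p ∈ framePairs, p ∈
      explore (frameWordsFour.map fun l => Prod.map (wordAct l) (wordAct l)) 20
        [(((0, false), (2, false)) : (ℕ × Bool) × (ℕ × Bool))] [((0, false), (2, false))] := by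
    decide +kernel
  exact (key _ (hmem p hp)).2.2

theorem exists_framePair {w : W 4} (hw : w ∈ rootStabilizer (frame 4 [0, 2, 14, 59])) :
    ∃ p ∈ framePairs, geom 4 w (simpleRoot 0) = root 4 p.1 ∧
      geom 4 w (simpleRoot 2) = root 4 p.2 := by
  obtain ⟨⟨n, b⟩, hx, hwx⟩ := geom_mem_frame_union hw (n := 0) (by simp)
  obtain ⟨⟨m, c⟩, hy, hwy⟩ := geom_mem_frame_union hw (n := 2) (by simp)
  have hwx' : geom 4 w (simpleRoot 0) = root 4 (n, b) := by
    rw [← isH_four.root_zero]; exact hwx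
  have hwy' : geom 4 w (simpleRoot 2) = root 4 (m, c) := by
    rw [← root_two_four]; exact hwy
  refine ⟨((n, b), (m, c)), ?_, hwx', hwy'⟩
  have hne : n ≠ m := by
    rintro rfl
    have : geom 4 w (simpleRoot 0) = geom 4 w (simpleRoot 2) ∨
        geom 4 w (simpleRoot 0) = geom 4 w (-simpleRoot 2) := by
      rw [map_neg, hwx', hwy']
      cases b <;> cases c <;> simp [root]
    have h02 : (simpleRoot 0 : V 4) = simpleRoot 2 ∨ (simpleRoot 0 : V 4) = -simpleRoot 2 :=
      this.imp (fun h => geom_injective w h) fun h => geom_injective w h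
    rcases h02 with h | h
    · have := congrFun h 0
      simp [simpleRoot] at this
    · have := congrFun h 0
      simp [simpleRoot] at this
  have hL : ∀ n ∈ [0, 2, 14, 59], ∀ m ∈ [0, 2, 14, 59], ∀ b c : Bool, n ≠ m →
      (((n, b), (m, c)) : (ℕ × Bool) × (ℕ × Bool)) ∈ framePairs := by decide +kernel
  exact hL n hx m hy b c hne

theorem geom_pair_eq_iff (g g' : W 4) :
    ((geom 4 g (simpleRoot 0), geom 4 g (simpleRoot 2)) : V 4 × V 4) =
      (geom 4 g' (simpleRoot 0), geom 4 g' (simpleRoot 2)) ↔ g⁻¹ * g' ∈ pairFixer := by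
  rw [Prod.mk.injEq, geom_eq_geom_iff, geom_eq_geom_iff]
  rfl

/-- Unlike in H₃, the stabilizer of β₁ does not preserve the frame, so ordered pairs of frame roots
are used: the generated group is transitive on them and contains the stabilizer of (β₁, β₃). -/
theorem rootStabilizer_le_frameGroupFour :
    rootStabilizer (frame 4 [0, 2, 14, 59]) ≤ frameGroupFour := by
  intro w hw
  obtain ⟨p, hp, h0, h2⟩ := exists_framePair hw
  obtain ⟨u, hu, hu0, hu2⟩ := exists_frameGroupFour hp
  have : u⁻¹ * w ∈ frameGroupFour := by
    apply pairFixer_le_frameGroupFour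
    rw [← geom_pair_eq_iff, hu0, hu2, h0, h2]
  have := mul_mem hu this
  rwa [mul_inv_cancel_left] at this

/-- There are 8 · 6 ordered pairs of signed frame roots on different axes, each with a stabilizer of
order 4. -/
theorem card_rootStabilizer_frame_four :
    Nat.card (rootStabilizer (frame 4 [0, 2, 14, 59])) = 192 := by
  rw [card_eq_ncard_image_mul (pairFixer_le_frameGroupFour.trans frameGroupFour_le_rootStabilizer)
    (fun w => ((geom 4 w (simpleRoot 0), geom 4 w (simpleRoot 2)) : V 4 × V 4)) geom_pair_eq_iff]
  have himg : (fun w => ((geom 4 w (simpleRoot 0), geom 4 w (simpleRoot 2)) : V 4 × V 4)) ''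
      (rootStabilizer (frame 4 [0, 2, 14, 59]) : Set (W 4)) =
      Prod.map (root 4) (root 4) '' (framePairs.toFinset : Set ((ℕ × Bool) × (ℕ × Bool))) := by
    ext v
    constructor
    · rintro ⟨w, hw, rfl⟩
      obtain ⟨p, hp, h0, h2⟩ := exists_framePair hw
      exact ⟨p, by simpa using hp, Prod.ext h0.symm h2.symm⟩
    · rintro ⟨p, hp, rfl⟩
      obtain ⟨u, hu, h0, h2⟩ := exists_frameGroupFour (p := p) (by simpa using hp)
      exact ⟨u, frameGroupFour_le_rootStabilizer hu, Prod.ext h0 h2⟩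
  rw [himg, Set.InjOn.ncard_image, Set.ncard_coe_finset, card_pairFixer,
    show framePairs.toFinset.card = 48 by decide +kernel]
  have hlt : ∀ p ∈ framePairs, p.1.1 < numRoots 4 ∧ p.2.1 < numRoots 4 := by decide +kernel
  intro p hp q hq h
  have hp' := hlt p (by simpa using hp)
  have hq' := hlt q (by simpa using hq)
  have hinj := root_injOn isH_four.nodup
  exact Prod.ext (hinj hp'.1 hq'.1 (congrArg Prod.fst h)) (hinj hp'.2 hq'.2 (congrArg Prod.snd h))

theorem isReduced_four {a : Br 4} (ha : a ∈ BrM 4) : IsReduced a := by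
  have hcol := isH_four.collapses fixer_four_le_centralizerE orbitCheck_four
  refine isReduced_of_mem ?_ (fun w => (hcol w).imp_right And.left) ?_ ha
  · intro i
    fin_cases i
    · exact ⟨1, by simp⟩
    · exact ⟨_, e_one_conj⟩
    · exact ⟨_, e_two_conj isH_four.start⟩
    · exact ⟨_, e_three_conj⟩
  · intro w
    by_contra! hno
    have hrot := rot135_mem_fixerEE isH_four.start
    have h : ∀ κ ∈ fixerEE 4,
        ip 4 (geom 4 w⁻¹ (simpleRoot 0)) (geom 4 κ (simpleRoot 0)) = 0 := by
      intro κ hκ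
      have := ((hcol (w * κ)).resolve_left (hno κ hκ)).2
      rwa [geom_mul_apply, ip_comm, ← ip_geom w⁻¹, geom_inv_apply] at this
    have h0 := h 1 (one_mem _)
    have h5 := h _ hrot
    have h2 := h _ (inv_mem hrot)
    -- This κ carries β₁ to β₇, whose β₄-coefficient is nonzero modulo the span of β₃ and β₅; hence
    -- orthogonality to β₄ follows.
    have h7 := h _ (mul_mem rot357_mem_fixerEE hrot)
    rw [map_one, Module.End.one_apply] at h0
    rw [rot135_four_zero] at h5
    rw [rot135_inv_four_zero] at h2
    have h59 : geom 4 (rot357 * rot135 4) (simpleRoot 0) = beta7 := by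
      rw [← wordProd_rot357Word, ← wordProd_rot135Word, ← wordProd_append,
        isH_four.geom_wordProd_simpleRoot_zero, beta7_eq,
        show wordAct (rot357Word ++ rot135Word 4) (0, false) = (59, false) by decide +kernel]
      rfl
    rw [h59, beta7, map_add, map_add, map_smul, map_smul, map_smul, h5, h2] at h7
    have h3 : ip 4 (geom 4 w⁻¹ (simpleRoot 0)) (simpleRoot 3) = 0 := by
      have := Real.goldenRatio_ne_zero
      simpa [this] using h7
    refine IsH.ip_self_ne_zero w⁻¹ fun i => ?_
    fin_cases i
    · exact h0
    · exact IsH.ip_one_eq_zero h0 h2 h5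
    · exact h2
    · exact h3

/-- The central element of `⟨r₃, r₄, r₅⟩`. -/
def central : W 4 := (r5 4 * s 2 * s 3) ^ 5

def centralWord : List (Fin 4) :=
  (List.replicate 5 (r5Word 4 ++ [2, 3])).flatten

theorem wordProd_centralWord : wordProd centralWord = central := by
  simp only [centralWord, central, List.replicate, List.flatten_cons, List.flatten_nil,
    List.append_nil, wordProd_append, wordProd_r5Word, wordProd_cons, wordProd_nil, pow_succ,
    pow_zero, one_mul, mul_one, mul_assoc]

theorem card_closure_central : Nat.card (Subgroup.closure {central}) = 2 := by
  rw [← Subgroup.zpowers_eq_closure, Nat.card_zpowers]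
  refine orderOf_eq_prime ?_ ?_
  · rw [← wordProd_centralWord, pow_two, ← wordProd_append]
    exact isH_four.ext (l' := []) (by decide +kernel)
  · rw [← wordProd_centralWord]
    -- The fifth power of a Coxeter element of type H₃, whose Coxeter number is 10, acts as -1 on
    -- its root system, so it moves β₃.
    exact isH_four.wordProd_ne (x := (2, false)) (l' := []) (by decide) (by decide +kernel)

theorem central_mem : central ∈ Subgroup.closure {s 2, s 3, r5 4} := by
  have h : ∀ w ∈ ({s 2, s 3, r5 4} : Set (W 4)), w ∈ Subgroup.closure {s 2, s 3, r5 4} :=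
    fun w hw => Subgroup.subset_closure hw
  exact pow_mem (mul_mem (mul_mem (h _ (by simp)) (h _ (by simp))) (h _ (by simp))) 5

/-- The extra defining relation for k = 4, with r₅r₃r₄ written out in simple reflections, and moved
to the left of e₁ by commutation. -/
theorem toBr_central_mul_e : toBr 4 central * e 0 = e 0 := by
  have hc : toBr 4 central * e 0 = e 0 * toBr 4 central :=
    fixer_four_le_centralizerE (fixer_four ▸ central_mem)
  have h := mkAlgHom_eq (k := 4) (Rel.h4 rfl)
  simp only [map_mul, map_pow, ← r_def, ← e_def] at h
  -- Both occurrences of e₁ are expanded and the left one is folded back, so that the two words are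
  -- compared.
  rw [hc, ← h]
  conv_lhs => rw [h]
  congr 1
  rw [central, map_pow]
  congr 1
  simp only [r5, mul_inv_rev, s_inv, map_mul, toBr_s, mul_assoc]

theorem toBr_mul_e_of_mem {z : W 4} (hz : z ∈ Subgroup.closure {central}) :
    toBr 4 z * e 0 = e 0 := by
  induction hz using Subgroup.closure_induction with
  | mem x hx => obtain rfl := hx; exact toBr_central_mul_e
  | one => simp
  | mul x y _ _ hx hy => rw [map_mul, mul_assoc, hy, hx]
  | inv x _ hx => conv_lhs => rw [← hx, ← mul_assoc, toBr_inv_mul, one_mul]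

theorem normalForms_four (D₁ C₁ D₂ : Set (W 4))
    (hD₁ : IsLeftTransversal D₁ (rootStabilizer {simpleRoot 0}) ⊤)
    (hC₁ : IsLeftTransversal C₁ (Subgroup.closure {(r5 4 * s 2 * s 3) ^ 5})
      (Subgroup.closure {s 2, s 3, r5 4}))
    (hD₂ : IsLeftTransversal D₂ (rootStabilizer {simpleRoot 0, simpleRoot 2, beta5 4, beta7}) ⊤) :
    (∀ a ∈ BrM 4, ∃ n : ℤ, ∃ f ∈ normalForms D₁ C₁ D₂, a = deltaPow n • f.eval) ∧
      (normalForms D₁ C₁ D₂).ncard = 236025 := by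
  rw [frame_four] at hD₂
  change IsLeftTransversal C₁ (Subgroup.closure {central}) _ at hC₁
  constructor
  · refine exists_normalForm (C := fixer (simpleRoot 0)) (fun a => isReduced_four) hD₁ hD₂
      (fun n hn => mem_or_mul_mem le_rfl hn) fixer_four_le_centralizerE (fun c hc => ?_)
      (rootStabilizer_le_frameGroupFour.trans frameGroupFour_le_fixerEE)
    rw [fixer_four] at hc
    obtain ⟨d, ⟨hd, hdc⟩, -⟩ := hC₁.2 c hc
    refine ⟨d, hd, fixer_four ▸ hC₁.1 hd, ?_⟩
    rw [← mul_inv_cancel_left d c, map_mul, mul_assoc, toBr_mul_e_of_mem hdc]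
  · have hfin : Finite (W 4) := Nat.finite_of_card_ne_zero (by rw [card_W_four]; norm_num)
    have h1 := hD₁.ncard_mul le_top
    have h2 := hD₂.ncard_mul le_top
    have h3 := hC₁.ncard_mul (by
      rw [Subgroup.closure_le, Set.singleton_subset_iff]; exact central_mem)
    rw [Subgroup.card_top, card_W_four, card_rootStabilizer_singleton, fixer_four,
      card_closure_four] at h1
    rw [Subgroup.card_top, card_W_four, card_rootStabilizer_frame_four] at h2
    rw [card_closure_central, card_closure_four] at h3
    -- The indices are 14400 / 240, 14400 / 192 and 120 / 2.
    have e1 : D₁.ncard = 60 := by omega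
    have e2 : D₂.ncard = 75 := by omega
    have e3 : C₁.ncard = 60 := by omega
    rw [ncard_normalForms, card_W_four, e1, e2, e3]
    rfl

end four

end BrauerH

open BrauerH in
theorem mainTheorem3 :
    (∀ D₁ C₁ D₂ : Set (W 3),
      IsLeftTransversal D₁ (rootStabilizer {simpleRoot 0}) ⊤ →
      C₁ = Subgroup.closure {s 2, r5 3} →
      IsLeftTransversal D₂ (rootStabilizer {simpleRoot 0, simpleRoot 2, beta5 3}) ⊤ →
        (∀ a ∈ BrM 3, ∃ n : ℤ, ∃ f ∈ normalForms D₁ C₁ D₂, a = deltaPow n • f.eval) ∧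
        (normalForms D₁ C₁ D₂).ncard = 1045) ∧
    (∀ D₁ C₁ D₂ : Set (W 4),
      IsLeftTransversal D₁ (rootStabilizer {simpleRoot 0}) ⊤ →
      IsLeftTransversal C₁ (Subgroup.closure {(r5 4 * s 2 * s 3) ^ 5})
        (Subgroup.closure {s 2, s 3, r5 4}) →
      IsLeftTransversal D₂ (rootStabilizer {simpleRoot 0, simpleRoot 2, beta5 4, beta7}) ⊤ →
        (∀ a ∈ BrM 4, ∃ n : ℤ, ∃ f ∈ normalForms D₁ C₁ D₂, a = deltaPow n • f.eval) ∧
        (normalForms D₁ C₁ D₂).ncard = 236025) := by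
  exact ⟨fun _ _ _ hD₁ hC₁ hD₂ => normalForms_three _ _ _ hD₁ hC₁ hD₂,
    fun _ _ _ hD₁ hC₁ hD₂ => normalForms_four _ _ _ hD₁ hC₁ hD₂⟩
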